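/- **Notation.** Let $d\ge 2$ and $k\ge 0$ be integers. A word $\boldsymbol i=(i_1,\dots,i_m)\in\{1,\dots,d\}^m$ has length $m$ and parent $\wp(\boldsymbol i)=(i_1,\dots,i_{m-1})$; the empty word is the root. Let $I_k$ be the set of words of length between $1$ and $k$. Given reals $\lambda_{\boldsymbol i}>1$ and $v_{\boldsymbol i}$ for $\boldsymbol i\in I_k$, put $\ell_{\boldsymbol i}(x)=\lambda_{\boldsymbol i}x$, $$\widetilde\lambda_{\boldsymbol i}=\lambda_{\boldsymbol i}\lambda_{\wp(\boldsymbol i)}\cdots\lambda_{\wp^{m-1}(\boldsymbol i)}\ (\boldsymbol i\text{ of length }m),\qquad \widetilde\lambda_{\emptyset}=1,\qquad \widetilde\lambda_{tot}^{-1}=\sum_{\boldsymbol i\in\{1,\dots,d\}^k}\widetilde\lambda_{\boldsymbol i}^{-1}.$$ The discretization of a map $f:\mathbb R\to\mathbb R$ is $\widehat f:\mathbb Z\to\mathbb Z$, where $\widehat f(x)$ is the integer with $\widehat f(x)-f(x)\in\,]-\frac12,\frac12]$. For $\boldsymbol i\in\{1,\dots,d\}^k$, $x\in\mathbb Z$ and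 $0\le m\le k$, let $x^{(m)}_{\boldsymbol i}$ be the image of $x$ under the discretizations of $\ell_{\boldsymbol i}+v_{\boldsymbol i}$, then $\ell_{\wp(\boldsymbol i)}+v_{\wp(\boldsymbol i)}$, up to $\ell_{\wp^{m-1}(\boldsymbol i)}+v_{\wp^{m-1}(\boldsymbol i)}$ (so $x^{(0)}_{\boldsymbol i}=x$), and for $1\le m\le k$ let $$e^m_{x,\boldsymbol i}=x^{(m)}_{\boldsymbol i}-(\ell_{\wp^{m-1}(\boldsymbol i)}+v_{\wp^{m-1}(\boldsymbol i)})(x^{(m-1)}_{\boldsymbol i})$$ be the roundoff error at the $m$-th iteration. Let $\mu=\sum_{\boldsymbol i\in\{1,\dots,d\}^k}\sum_{x\in\mathbb Z}\delta_{x^{(k)}_{\boldsymbol i}}$ and, for $y'\in\mathbb Z$, let $\mu-y'$ be its translate by $-y'$. For measures $\mu,\nu$ on $\mathbb R$ and $y,R>0$ put $$c\delta_y(\mu,\nu)=\mu(]0,y])+\tfrac12\mu(\{0\})-\nu(]0,y])-\tfrac12\nu(\{0\}),\qquad \mathrm{d}_{C,R}(\mu,\nu)=\Big(\frac1R\int_0^R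 c\delta_y(\mu,\nu)^2\,dy\Big)^{1/2}.$$ For $\boldsymbol i,\boldsymbol i'\in\{1,\dots,d\}^k$ let $k_0(\boldsymbol i,\boldsymbol i')=\min\{m\in\{0,\dots,k\}:\wp^m(\boldsymbol i)=\wp^m(\boldsymbol i')\}$. For $E\subset\mathbb R$ let $$D_R^+(E)=\sup_{x\in\mathbb R}\frac{\operatorname{Card}(E\cap[x-R,x+R])}{\operatorname{Card}(\mathbb Z\cap[x-R,x+R])}.$$ **Statement.** For all integers $\ell',c\ge1$, put $L=(k\,d^k+1)\,\ell'$. There is a locally finite (in $]1,+\infty[^{I_k}$) countable family of submanifolds $V_q$ of positive codimension of $]1,+\infty[^{I_k}$ such that for every $\eta'>0$ there is $R_0>0$ such that, for all reals $\lambda_{\boldsymbol i}>1$ ($\boldsymbol i\in I_k$) with $d\big((\widetilde\lambda_{\boldsymbol i})_{\boldsymbol i\in I_k},V_q\big)>\eta'$ for every $q$ (Euclidean distance, equal to $+\infty$ if $V_q=\emptyset$), every $R\ge R_0$ and every real family $(v_{\boldsymbol i})_{\boldsymbol i\in I_k}$, the following hold. Call $y'\in\mathbb Z$ *good* if for every $\boldsymbol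 i\in\{1,\dots,d\}^k$ there is exactly one $x_{\boldsymbol i}\in\mathbb Z$ with $(x_{\boldsymbol i})^{(k)}_{\boldsymbol i}=y'$, and $|e^m_{x_{\boldsymbol i},\boldsymbol i}|\le \frac1L\ \big(\le\frac1{\ell'}\big)$ for all $\boldsymbol i\in\{1,\dots,d\}^k$ and $1\le m\le k$. 1. For every $y\in\mathbb Z$ there is a good $y'\in\mathbb Z$ with $|y-y'|\le R_0$. 2. For every good $y'$, $$\left|\frac1R\int_0^R c\delta_x\big(\mu-y',\ \widetilde\lambda_{tot}^{-1}\operatorname{Leb}\big)\,dx\right|\le\frac1{\ell'}.$$ 3. For every good $y'$, $$\left|\mathrm{d}_{C,R}^2\big(\mu-y',\ \widetilde\lambda_{tot}^{-1}\operatorname{Leb}\big)-\frac1{12\,\widetilde\lambda_{tot}^{2}}-\frac1{12}\sum_{\boldsymbol i,\boldsymbol i'\in\{1,\dots,d\}^k}\ \sum_{m=k_0(\boldsymbol i,\boldsymbol i')}^{k-1}\frac{\widetilde\lambda_{\wp^m(\boldsymbol i)}\widetilde\lambda_{\wp^m(\boldsymbol i')}}{\widetilde\lambda_{\boldsymbol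 i}\widetilde\lambda_{\boldsymbol i'}}\right|<\frac1{\ell'}.$$ 4. For every $\boldsymbol i\in\{1,\dots,d\}^k$ and $0\le m<k$, $$D_R^+\Big\{x\in(\ell_{\wp^m(\boldsymbol i)}+v_{\wp^m(\boldsymbol i)})(\mathbb Z)\ :\ d\big(x,\mathbb Z+\tfrac12\big)<\frac1{3c\ell'}\Big\}<\frac1{c\ell'}.$$ -/

import Mathlib

open MeasureTheory Set
open scoped ENNReal Topology ContDiff

namespace TreeLinear

noncomputable section

/-! ## The complete `d`-ary tree of order `k`

A vertex is a word in the alphabet `Fin d`; the root is the empty word. -/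

/-- The index set `I_k`: words of length between `1` and `k`. -/
abbrev Node (d k : ℕ) : Type := {w : List (Fin d) // 1 ≤ w.length ∧ w.length ≤ k}

/-- The words of length exactly `k`. -/
abbrev Leaf (d k : ℕ) : Type := List.Vector (Fin d) k

theorem finite_node (d k : ℕ) : Finite (Node d k) :=
  ((List.finite_length_le (Fin d) k).subset (fun _ hw => hw.2)).to_subtype

instance instFintypeNode (d k : ℕ) : Fintype (Node d k) :=
  @Fintype.ofFinite _ (finite_node d k)

/-- The `m`-th ancestor `℘^m(w)`, where `℘` erases the last letter. -/
def ancestor {d : ℕ} (m : ℕ) (w : List (Fin d)) : List (Fin d) := List.dropLast^[m] w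

/-- `k₀(i,i')`: the least `m ∈ {0,…,k}` with `℘^m(i) = ℘^m(i')`. -/
def meetTime {d k : ℕ} (i i' : Leaf d k) : ℕ :=
  sInf {m : ℕ | m ≤ k ∧ ancestor m i.toList = ancestor m i'.toList}

/-! ## Multipliers

A family indexed by `I_k` is given by a function on all words, of which only the values at words of
length between `1` and `k` are ever used. -/

/-- The product of the multipliers along the path from `w` to the root (`1` at the root). -/
def prodMult {d : ℕ} (lam : List (Fin d) → ℝ) (w : List (Fin d)) : ℝ :=
  ∏ m ∈ Finset.range w.length, lam (ancestor m w)

/-- The point of `ℝ^{I_k}` whose coordinates are the products `prodMult lam w`. -/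
def prodMultVec {d : ℕ} (k : ℕ) (lam : List (Fin d) → ℝ) : EuclideanSpace ℝ (Node d k) :=
  WithLp.toLp 2 (fun w => prodMult lam w.1)

/-- The total multiplier, whose inverse is the sum over the leaves of the inverse products. -/
def totalMult {d : ℕ} (k : ℕ) (lam : List (Fin d) → ℝ) : ℝ :=
  (∑ i : Leaf d k, (prodMult lam i.toList)⁻¹)⁻¹

/-! ## Discretizations -/

/-- The discretization of `f : ℝ → ℝ`; `round` rounds half-integers up. -/
def discretization (f : ℝ → ℝ) (x : ℤ) : ℤ := round (f x)

/-- `discretization f x` is the unique integer `n` with `n - f x ∈ ]-1/2, 1/2]`. -/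
theorem discretization_eq_iff (f : ℝ → ℝ) (x n : ℤ) :
    discretization f x = n ↔ (n : ℝ) - f x ∈ Ioc (-(1 / 2) : ℝ) (1 / 2) := by
  unfold discretization
  rw [round_eq, Int.floor_eq_iff, mem_Ioc]
  constructor <;> rintro ⟨h1, h2⟩ <;> constructor <;> linarith

/-- The affine map `ℓ_w + v_w`. -/
def affineMap {d : ℕ} (lam v : List (Fin d) → ℝ) (w : List (Fin d)) (x : ℝ) : ℝ :=
  lam w * x + v w

/-- The point obtained from `x` by applying successively the discretizations of the affine maps
at `w, ℘(w), …, ℘^{m-1}(w)`. -/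
def discOrbit {d : ℕ} (lam v : List (Fin d) → ℝ) (w : List (Fin d)) : ℕ → ℤ → ℤ
  | 0, x => x
  | m + 1, x => discretization (affineMap lam v (ancestor m w)) (discOrbit lam v w m x)

/-- The roundoff error made at the `(m+1)`-th iteration along the path starting from `w`. -/
def roundoffError {d : ℕ} (lam v : List (Fin d) → ℝ) (w : List (Fin d)) (m : ℕ) (x : ℤ) : ℝ :=
  (discOrbit lam v w (m + 1) x : ℝ) - affineMap lam v (ancestor m w) (discOrbit lam v w m x)

/-- The integer `y'` has exactly one preimage in each of the `d^k` branches, and all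
the roundoff errors of these preimages are at most `ε` in absolute value. -/
def HasSmallErrors {d : ℕ} (k : ℕ) (lam v : List (Fin d) → ℝ) (ε : ℝ) (y' : ℤ) : Prop :=
  ∃ x : Leaf d k → ℤ, ∀ i : Leaf d k,
    (∀ z : ℤ, discOrbit lam v i.toList k z = y' ↔ z = x i) ∧
    ∀ m < k, |roundoffError lam v i.toList m (x i)| ≤ ε

/-- The image measure: the sum over all branches `i` and all `x ∈ ℤ` of the Dirac mass at the
image of `x` by the composition of the discretizations along the branch `i`. -/
def imageMeasure {d : ℕ} (k : ℕ) (lam v : List (Fin d) → ℝ) : Measure ℝ :=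
  Measure.sum (fun p : Leaf d k × ℤ =>
    Measure.dirac ((discOrbit lam v p.1.toList k p.2 : ℤ) : ℝ))

/-- The translate of a measure by `-a`. -/
def translateNeg (μ : Measure ℝ) (a : ℝ) : Measure ℝ := μ.map (fun t => t - a)

/-- The measure `c • Leb`. -/
def scaledLeb (c : ℝ) : Measure ℝ := ENNReal.ofReal c • volume

/-! ## Cumulated difference and Cramér distance -/

/-- The cumulated difference of two measures on `ℝ` at `y`. -/
def cumDiff (μ ν : Measure ℝ) (y : ℝ) : ℝ :=
  μ.real (Ioc 0 y) + 1 / 2 * μ.real {0} - ν.real (Ioc 0 y) - 1 / 2 * ν.real {0}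

/-- The Cramér distance on the window `[0,R]`. -/
def cramerDist (R : ℝ) (μ ν : Measure ℝ) : ℝ :=
  Real.sqrt (1 / R * ∫ y in (0 : ℝ)..R, cumDiff μ ν y ^ 2)

/-- The value of the Cramér distance squared predicted for independent uniform errors. -/
def cramerFormula {d : ℕ} (k : ℕ) (lam : List (Fin d) → ℝ) : ℝ :=
  1 / (12 * totalMult k lam ^ 2) +
    1 / 12 * ∑ i : Leaf d k, ∑ i' : Leaf d k, ∑ m ∈ Finset.Ico (meetTime i i') k,
      prodMult lam (ancestor m i.toList) * prodMult lam (ancestor m i'.toList) /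
        (prodMult lam i.toList * prodMult lam i'.toList)

/-- The uniform upper density at scale `R` of a set `E ⊆ ℝ`, relative to `ℤ`. -/
def upperDensity (R : ℝ) (E : Set ℝ) : ℝ≥0∞ :=
  ⨆ x : ℝ, ((E ∩ Icc (x - R) (x + R)).encard : ℝ≥0∞) /
    ((range (fun n : ℤ => (n : ℝ)) ∩ Icc (x - R) (x + R)).encard : ℝ≥0∞)

/-- The set `ℤ + 1/2`. -/
def halfIntegers : Set ℝ := range (fun n : ℤ => (n : ℝ) + 1 / 2)

/-- The points of `(ℓ_w + v_w)(ℤ)` at distance less than `r` from `ℤ + 1/2`. -/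
def nearHalf {d : ℕ} (lam v : List (Fin d) → ℝ) (w : List (Fin d)) (r : ℝ) : Set ℝ :=
  {x | x ∈ range (fun n : ℤ => affineMap lam v w n) ∧ Metric.infDist x halfIntegers < r}

/-! ## Submanifolds of positive codimension -/

/-- The open set `]1,+∞[^{I_k}`. -/
def multiplierSpace (d k : ℕ) : Set (EuclideanSpace ℝ (Node d k)) := {z | ∀ w, 1 < z w}

/-- `V` is a smooth (embedded) submanifold of positive codimension: around each of its points it
is the zero set of a smooth submersion to some `ℝ^p` with `p ≥ 1`. -/
def IsPosCodimSubmanifold {E : Type*} [NormedAddCommGroup E] [NormedSpace ℝ E]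
    (V : Set E) : Prop :=
  ∀ x ∈ V, ∃ p : ℕ, 1 ≤ p ∧ ∃ U : Set E, IsOpen U ∧ x ∈ U ∧
    ∃ g : E → EuclideanSpace ℝ (Fin p), ContDiffOn ℝ ∞ g U ∧
      (∀ z ∈ U, Function.Surjective (fderiv ℝ g z)) ∧ ∀ z ∈ U, z ∈ V ↔ g z = 0

/-- A sequence (possibly with empty terms) of submanifolds of positive codimension of the space
`]1,+∞[^{I_k}`, locally finite in that space. -/
def IsLocFiniteSubmanifolds {d k : ℕ} (V : ℕ → Set (EuclideanSpace ℝ (Node d k))) : Prop :=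
  (∀ q, V q ⊆ multiplierSpace d k) ∧ (∀ q, IsPosCodimSubmanifold (V q)) ∧
    ∀ z ∈ multiplierSpace d k, ∃ U ∈ 𝓝 z, {q | (V q ∩ U).Nonempty}.Finite

end

end TreeLinear

/-!
The discretized branches are inverted from the root: for a word `w` the integers mapped into `]-∞, Y]`
by the discretized maps at `w, ℘(w), …` are those up to `backCount lam v w Y`, which is obtained from
the value at the parent by one affine map and one rounding. Writing the rounding as a defect in
`]0, 1]`, `backCount` is `Y / prodMult lam w` plus a constant minus a weighted sum of the defects of
the nonempty ancestors-or-self of `w` (`backCount_sub`). Hence, seen from an integer `y'` with small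
errors, the cumulated difference at `t` is a centred sawtooth in `t`, minus a weighted sum of centred
defects at `y' + ⌊t⌋` (the fluctuation), plus a constant controlled by the errors at `y'` (the bias):
this is `cumDiff_eq`. The formula for the Cramér distance is the variance of this expression when the
defects of distinct words are independent and uniform.

Independence comes from return times. If `1` and the inverse products of the multipliers satisfy no
integer relation of bounded size, Kronecker's theorem in uniform form (`exists_returns`) provides
bounded integers `h` such that the translation by `h` moves the phase of one prescribed word `w` by a
prescribed amount and almost fixes all other phases. Unless some defect on the path is close to its
discontinuity, such a translation moves the defect of `w` by the same amount modulo `1` and almost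
fixes the defects of all other words that are not longer than `w`. Averaging over shifts by multiples
of `1 / Q` shows first that the exceptional integers are rare (`irregularCount_le`), then that the
centred defects have small means and correlations over long windows
(`abs_sum_defect_mul_le`, `abs_sum_defect_correlation_le`). The same return times move any integer to
one with small errors (`exists_hasSmallErrors`), and return times for a single multiplier give
disjoint translates of the set of points near half-integers, which bounds its density
(`upperDensity_nearHalf_lt`).

The order of the relations to be avoided depends only on a bound `M` for the products of the
multipliers. The hypersurfaces are therefore the relations of order at most `N M`, each restricted to
the region where some coordinate exceeds `M - 2`, so that the family is locally finite. To them are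
added cuts `z w = const` accumulating at `1` and increasingly dense at infinity: a point far from these
has all coordinates in a compact part of `]1, +∞[`. Being far from the hypersurfaces then gives a
quantitative nonresonance (`nonResonant_of_far`), uniform in all the remaining data.
-/

namespace TreeLinear

/-! ### Simultaneous inhomogeneous approximation -/

/-- Integers `h ≤ H` bring `h α` within `κ` of every target `s` modulo `ℤ^ι`. -/
def HasReturns {ι : Type*} (α : ι → ℝ) (κ : ℝ) (H : ℕ) : Prop :=
  ∀ s : ι → ℝ, ∃ h : ℕ, h ≤ H ∧ ∃ a : ι → ℤ, ∀ w, |h * α w - s w - a w| ≤ κ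

/-- The numbers `1, α w` satisfy no integer relation with coefficients of `α` bounded by `N`, even
up to an error `δ`. -/
def NonResonant {ι : Type*} [Fintype ι] (α : ι → ℝ) (N : ℕ) (δ : ℝ) : Prop :=
  ∀ n : ι → ℤ, n ≠ 0 → (∀ w, |n w| ≤ N) → ∀ m : ℤ, δ ≤ |∑ w, n w * α w - m|

theorem cos_pow_two_mul_eq_sum (p : ℕ) (x : ℝ) :
    ((Real.cos (Real.pi * x) ^ (2 * p) : ℝ) : ℂ) =
      ∑ j ∈ Finset.range (2 * p + 1), (((2 * p).choose j / 4 ^ p : ℝ) : ℂ) *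
        Complex.exp (2 * Real.pi * Complex.I * (((j : ℤ) - p : ℤ) * x)) := by
  have h1 : ((Real.cos (Real.pi * x) : ℝ) : ℂ) =
      (Complex.exp (Real.pi * x * Complex.I) + Complex.exp (-(Real.pi * x * Complex.I))) / 2 := by
    rw [Complex.ofReal_cos, Complex.cos]; push_cast; ring_nf
  push_cast at h1 ⊢
  rw [h1, div_pow, add_pow, Finset.sum_div]
  refine Finset.sum_congr rfl fun j hj => ?_
  have hj' : j ≤ 2 * p := by simpa [Nat.lt_succ_iff] using hj
  have h4 : (2 : ℂ) ^ (2 * p) = 4 ^ p := by rw [pow_mul]; norm_num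
  rw [← Complex.exp_nat_mul, ← Complex.exp_nat_mul, ← Complex.exp_add, h4, Nat.cast_sub hj']
  have : (j : ℂ) * (Real.pi * x * Complex.I) +
      (((2 * p : ℕ) : ℂ) - j) * (-(Real.pi * x * Complex.I)) =
      2 * Real.pi * Complex.I * ((j - p) * x) := by push_cast; ring
  rw [this]; ring

theorem abs_cos_pi_mul_le {κ x : ℝ} (hκ : 0 ≤ κ) (h : κ ≤ |x - round x|) :
    |Real.cos (Real.pi * x)| ≤ Real.cos (Real.pi * κ) := by
  have h1 : |Real.cos (Real.pi * x)| = |Real.cos (Real.pi * (x - round x))| := by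
    rw [mul_sub, mul_comm Real.pi (round x : ℝ), Real.cos_sub_int_mul_pi, abs_mul]
    simp
  have h2 := abs_sub_round x
  rw [h1, ← Real.cos_abs, abs_mul, abs_of_pos Real.pi_pos, abs_of_nonneg]
  · apply Real.cos_le_cos_of_nonneg_of_le_pi
    · positivity
    · nlinarith [Real.pi_pos]
    · gcongr
  · apply Real.cos_nonneg_of_mem_Icc
    constructor <;> nlinarith [Real.pi_pos, abs_nonneg (x - round x)]

theorem norm_sum_exp_le {δ β : ℝ} (hδ : 0 < δ) (h : ∀ m : ℤ, δ ≤ |β - m|) (H : ℕ) :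
    ‖∑ t ∈ Finset.range H, Complex.exp (2 * Real.pi * Complex.I * (t * β))‖ ≤ 1 / δ := by
  set z : ℂ := Complex.exp (Complex.I * (2 * Real.pi * β : ℝ)) with hz
  have hsum : ∑ t ∈ Finset.range H, Complex.exp (2 * Real.pi * Complex.I * (t * β)) =
      ∑ t ∈ Finset.range H, z ^ t := by
    refine Finset.sum_congr rfl fun t _ => ?_
    rw [hz, ← Complex.exp_nat_mul]; congr 1; push_cast; ring
  have hnz : ‖z‖ = 1 := by
    rw [hz, mul_comm]; exact Complex.norm_exp_ofReal_mul_I _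
  have hz1 : 2 * δ ≤ ‖z - 1‖ := by
    rw [hz, Complex.norm_exp_I_mul_ofReal_sub_one, norm_mul, Real.norm_eq_abs, Real.norm_eq_abs]
    have e1 : 2 * Real.pi * β / 2 = Real.pi * (β - round β) + (round β : ℤ) * Real.pi := by ring
    have e2 : |Real.sin (2 * Real.pi * β / 2)| = |Real.sin (Real.pi * (β - round β))| := by
      rw [e1, Real.sin_add_int_mul_pi, abs_mul]; simp
    have e3 := abs_sub_round β
    have e4 := Real.mul_abs_le_abs_sin (x := Real.pi * (β - round β)) (by
      rw [abs_mul, abs_of_pos Real.pi_pos]; nlinarith [Real.pi_pos])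
    rw [abs_mul, abs_of_pos Real.pi_pos] at e4
    have e5 : 2 / Real.pi * (Real.pi * |β - round β|) = 2 * |β - round β| := by
      field_simp
    have e6 := h (round β)
    rw [e2, abs_of_pos (by norm_num : (0 : ℝ) < 2)]
    linarith
  have hne : z ≠ 1 := by
    rintro h; rw [h] at hz1; simp at hz1; linarith
  rw [hsum, geom_sum_eq hne, norm_div]
  have : ‖z ^ H - 1‖ ≤ 2 := by
    refine (norm_sub_le _ _).trans ?_
    rw [norm_pow, hnz]; norm_num
  rw [div_le_div_iff₀ (by linarith) hδ]
  nlinarith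

/-- The coefficients of the trigonometric polynomial `cos (π x) ^ (2 p)`. -/
noncomputable def cosCoeff (p j : ℕ) : ℝ := (2 * p).choose j / 4 ^ p

theorem cosCoeff_nonneg (p j : ℕ) : 0 ≤ cosCoeff p j := by unfold cosCoeff; positivity

theorem sum_cosCoeff (p : ℕ) : ∑ j ∈ Finset.range (2 * p + 1), cosCoeff p j = 1 := by
  unfold cosCoeff
  rw [← Finset.sum_div, ← Nat.cast_sum, Nat.sum_range_choose, pow_mul]
  push_cast; norm_num

theorem one_div_le_cosCoeff_self {p : ℕ} (hp0 : 0 < p) : 1 / (2 * p : ℝ) ≤ cosCoeff p p := by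
  have hp0' : (0 : ℝ) < p := by exact_mod_cast hp0
  have := Nat.four_pow_le_two_mul_self_mul_centralBinom p hp0
  rw [Nat.centralBinom] at this
  have h2 : (4 : ℝ) ^ p ≤ 2 * p * (2 * p).choose p := by exact_mod_cast this
  rw [cosCoeff, div_le_div_iff₀ (by positivity) (by positivity)]
  linarith

theorem prod_cos_eq_sum {ι : Type*} [Fintype ι] [DecidableEq ι] (p : ℕ) (x : ι → ℝ) :
    ((∏ w, Real.cos (Real.pi * x w) ^ (2 * p) : ℝ) : ℂ) =
      ∑ j ∈ Fintype.piFinset (fun _ : ι => Finset.range (2 * p + 1)),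
        ((∏ w, cosCoeff p (j w) : ℝ) : ℂ) *
        Complex.exp (2 * Real.pi * Complex.I * ((∑ w, (((j w : ℤ) - p : ℤ) : ℝ) * x w : ℝ))) := by
  rw [Complex.ofReal_prod]
  simp_rw [cos_pow_two_mul_eq_sum]
  rw [Finset.prod_univ_sum]
  refine Finset.sum_congr rfl fun j _ => ?_
  rw [Finset.prod_mul_distrib, ← Complex.exp_sum, Complex.ofReal_prod]
  congr 2
  rw [Complex.ofReal_sum, Finset.mul_sum]
  refine Finset.sum_congr rfl fun w _ => ?_
  push_cast; ring

/-- Along a nonresonant orbit the product kernel has mean at least its constant coefficient, up to a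
bounded sum of the other frequencies. -/
theorem le_sum_prod_cos {ι : Type*} [Fintype ι] {α : ι → ℝ} {p : ℕ} {δ : ℝ} (hδ : 0 < δ)
    (hα : NonResonant α p δ) (s : ι → ℝ) (H : ℕ) :
    H * cosCoeff p p ^ Fintype.card ι - 1 / δ ≤
      ∑ h ∈ Finset.range H, ∏ w, Real.cos (Real.pi * (h * α w - s w)) ^ (2 * p) := by
  classical
  set P := Fintype.piFinset (fun _ : ι => Finset.range (2 * p + 1)) with hP
  set T : (ι → ℕ) → ℂ := fun j => ∑ h ∈ Finset.range H, ((∏ w, cosCoeff p (j w) : ℝ) : ℂ) *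
    Complex.exp (2 * Real.pi * Complex.I *
      ((∑ w, (((j w : ℤ) - p : ℤ) : ℝ) * (h * α w - s w) : ℝ))) with hT
  have hexp : ((∑ h ∈ Finset.range H,
      ∏ w, Real.cos (Real.pi * (h * α w - s w)) ^ (2 * p) : ℝ) : ℂ) = ∑ j ∈ P, T j := by
    rw [Complex.ofReal_sum]
    simp_rw [prod_cos_eq_sum]
    rw [Finset.sum_comm]
  have hmem : (fun _ : ι => p) ∈ P := by
    rw [hP, Fintype.mem_piFinset]; intro _; rw [Finset.mem_range]; omega
  have hT0 : T (fun _ => p) = (H * cosCoeff p p ^ Fintype.card ι : ℝ) := by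
    simp [hT]
  have hTj : ∀ j ∈ P.erase (fun _ => p), ‖T j‖ ≤ (∏ w, cosCoeff p (j w)) * (1 / δ) := by
    intro j hj
    rw [Finset.mem_erase, hP, Fintype.mem_piFinset] at hj
    have hres := hα (fun w => (j w : ℤ) - p) (by
      intro h0; apply hj.1; funext w
      have := congrFun h0 w
      simp only [Pi.zero_apply] at this
      omega) (by
      intro w
      have := Finset.mem_range.1 (hj.2 w)
      rw [abs_le]; constructor <;> omega)
    have hs := norm_sum_exp_le hδ hres H
    have heq : T j = ((∏ w, cosCoeff p (j w) : ℝ) : ℂ) *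
        Complex.exp (((-(2 * Real.pi * ∑ w, (((j w : ℤ) - p : ℤ) : ℝ) * s w) : ℝ) : ℂ) * Complex.I) *
        ∑ h ∈ Finset.range H, Complex.exp (2 * Real.pi * Complex.I *
          (h * ((∑ w, (((j w : ℤ) - p : ℤ) : ℝ) * α w : ℝ) : ℂ))) := by
      simp only [hT]
      rw [Finset.mul_sum]
      refine Finset.sum_congr rfl fun h _ => ?_
      rw [mul_assoc ((∏ w, cosCoeff p (j w) : ℝ) : ℂ), ← Complex.exp_add]
      congr 2
      have : ∑ w, (((j w : ℤ) - p : ℤ) : ℝ) * (h * α w - s w) =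
          h * ∑ w, (((j w : ℤ) - p : ℤ) : ℝ) * α w - ∑ w, (((j w : ℤ) - p : ℤ) : ℝ) * s w := by
        rw [Finset.mul_sum, ← Finset.sum_sub_distrib]
        exact Finset.sum_congr rfl fun w _ => by ring
      rw [this, Complex.ofReal_neg, Complex.ofReal_sub, Complex.ofReal_mul, Complex.ofReal_mul,
        Complex.ofReal_mul]
      push_cast; ring
    rw [heq, norm_mul, norm_mul, Complex.norm_exp_ofReal_mul_I, mul_one, Complex.norm_real,
      Real.norm_of_nonneg (Finset.prod_nonneg fun w _ => cosCoeff_nonneg p _)]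
    exact mul_le_mul_of_nonneg_left hs (Finset.prod_nonneg fun w _ => cosCoeff_nonneg p _)
  have hsum1 : ∑ j ∈ P, ∏ w, cosCoeff p (j w) = 1 := by
    rw [hP, Finset.sum_prod_piFinset (Finset.range (2 * p + 1)) (fun _ j => cosCoeff p j)]
    simp [sum_cosCoeff]
  have hrest : ‖∑ j ∈ P.erase (fun _ => p), T j‖ ≤ 1 / δ := by
    refine (norm_sum_le_of_le _ hTj).trans ?_
    rw [← Finset.sum_mul]
    have : ∑ j ∈ P.erase (fun _ => p), ∏ w, cosCoeff p (j w) ≤ 1 := by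
      rw [← hsum1]
      exact Finset.sum_le_sum_of_subset_of_nonneg (Finset.erase_subset _ _)
        fun j _ _ => Finset.prod_nonneg fun w _ => cosCoeff_nonneg p _
    have hd : 0 < 1 / δ := by positivity
    nlinarith
  rw [← Finset.add_sum_erase _ _ hmem, hT0] at hexp
  have hre := congrArg Complex.re hexp
  rw [Complex.ofReal_re, Complex.add_re, Complex.ofReal_re] at hre
  have := (abs_le.1 ((Complex.abs_re_le_norm _).trans hrest)).1
  rw [hre]; linarith

/-- Kronecker's theorem in uniform form: how many integer relations have to be avoided depends on the
precision `κ` only, and how far they are avoided determines the return times. -/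
theorem exists_returns (ι : Type*) [Fintype ι] {κ : ℝ} (hκ : 0 < κ) (hκ2 : κ ≤ 1 / 2) :
    ∃ N : ℕ, ∀ δ : ℝ, 0 < δ → ∃ H : ℕ, ∀ α : ι → ℝ, NonResonant α N δ → HasReturns α κ H := by
  classical
  set D := Fintype.card ι
  obtain ⟨ρ, hρdef⟩ : ∃ ρ, ρ = Real.cos (Real.pi * κ) ^ 2 := ⟨_, rfl⟩
  have hc0 : 0 ≤ Real.cos (Real.pi * κ) := by
    apply Real.cos_nonneg_of_mem_Icc
    constructor <;> nlinarith [Real.pi_pos]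
  have hc1 : Real.cos (Real.pi * κ) < 1 := by
    rw [← Real.cos_zero]
    apply Real.cos_lt_cos_of_nonneg_of_le_pi le_rfl <;> nlinarith [Real.pi_pos]
  have hρ1 : ρ < 1 := by nlinarith
  have hρ0 : 0 ≤ ρ := by rw [hρdef]; positivity
  -- The value `ρ ^ p` of the kernel away from the target loses against its mean, which decays only
  -- polynomially in `p`.
  obtain ⟨p, hp0, hp⟩ : ∃ p : ℕ, 0 < p ∧ ρ ^ p < 1 / 2 * (1 / (2 * p : ℝ)) ^ D := by
    have ht := tendsto_pow_const_mul_const_pow_of_abs_lt_one D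
      (by rwa [abs_of_nonneg hρ0] : |ρ| < 1)
    have ht2 : ∀ᶠ p : ℕ in Filter.atTop, (p : ℝ) ^ D * ρ ^ p < 1 / 2 * (1 / 2) ^ D :=
      ht.eventually_lt_const (by positivity)
    obtain ⟨p, h1, h2⟩ := (ht2.and (Filter.eventually_gt_atTop 0)).exists
    refine ⟨p, h2, ?_⟩
    have hp : (0 : ℝ) < p := by exact_mod_cast h2
    have e : (1 / (2 * p : ℝ)) ^ D = (1 / 2) ^ D / p ^ D := by
      rw [← div_pow]; congr 1; field_simp
    rw [e, ← mul_div_assoc, lt_div_iff₀ (by positivity)]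
    linarith
  have hp0' : (0 : ℝ) < p := by exact_mod_cast hp0
  obtain ⟨c0, hc0def⟩ : ∃ c0, c0 = cosCoeff p p ^ D := ⟨_, rfl⟩
  have hcop := one_div_le_cosCoeff_self hp0
  have hle : (1 / (2 * p : ℝ)) ^ D ≤ c0 := by rw [hc0def]; gcongr
  have hc0pos : 0 < c0 := lt_of_lt_of_le (by positivity) hle
  have hρc : ρ ^ p < c0 / 2 := by linarith
  refine ⟨p, fun δ hδ => ?_⟩
  obtain ⟨H, hH⟩ := exists_nat_gt (2 / (δ * c0))
  refine ⟨H, fun α hα s => ?_⟩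
  by_contra! hcon
  have hfar : ∀ h ∈ Finset.range H,
      ∏ w, Real.cos (Real.pi * (h * α w - s w)) ^ (2 * p) ≤ ρ ^ p := by
    intro h hh
    obtain ⟨w, hw⟩ := hcon h (Finset.mem_range.1 hh).le (fun w => round (h * α w - s w))
    have h1 := abs_cos_pi_mul_le hκ.le hw.le
    rw [← Finset.mul_prod_erase _ _ (Finset.mem_univ w)]
    have h2 : Real.cos (Real.pi * (h * α w - s w)) ^ (2 * p) ≤ ρ ^ p := by
      rw [pow_mul, ← sq_abs, hρdef]; gcongr
    have h3 : ∏ w ∈ Finset.univ.erase w, Real.cos (Real.pi * (h * α w - s w)) ^ (2 * p) ≤ 1 := by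
      apply Finset.prod_le_one
      · intro i _; rw [pow_mul]; positivity
      · intro i _; rw [pow_mul]
        exact pow_le_one₀ (sq_nonneg _) (Real.cos_sq_le_one _)
    have h4 : 0 ≤ Real.cos (Real.pi * (h * α w - s w)) ^ (2 * p) := by
      rw [pow_mul]; positivity
    exact (mul_le_of_le_one_right h4 h3).trans h2
  have hsumle : ∑ h ∈ Finset.range H, ∏ w, Real.cos (Real.pi * (h * α w - s w)) ^ (2 * p) ≤
      H * ρ ^ p := by
    simpa using Finset.sum_le_card_nsmul _ _ _ hfar
  have hge := le_sum_prod_cos hδ hα s H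
  rw [div_lt_iff₀ (by positivity)] at hH
  have h5 : (H : ℝ) * ρ ^ p ≤ H * (c0 / 2) := by gcongr
  have h6 : H * c0 - 1 / δ ≤ H * (c0 / 2) := by
    rw [hc0def] at h5 ⊢; linarith
  have h7 : (H : ℝ) * c0 / 2 ≤ 1 / δ := by linarith
  rw [le_div_iff₀ hδ] at h7
  linarith

/-! ### Backward counting along the tree -/

/-- All multipliers at words of length between `1` and `k` are larger than `1`. -/
def Expanding {d : ℕ} (k : ℕ) (lam : List (Fin d) → ℝ) : Prop :=
  ∀ w : List (Fin d), w ≠ [] → w.length ≤ k → 1 < lam w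

/-- The generalized inverse of the discretized dynamics: `backCount lam v w Y` is the largest integer
which the discretized maps at `w, ℘(w), …` send into `]-∞, Y]`. -/
noncomputable def backCount {d : ℕ} (lam v : List (Fin d) → ℝ) (w : List (Fin d)) (Y : ℤ) : ℤ :=
  if w = [] then Y else ⌈((backCount lam v w.dropLast Y : ℝ) + 1 / 2 - v w) / lam w⌉ - 1
termination_by w.length
decreasing_by
  have := List.length_pos_iff.2 ‹_›
  rw [List.length_dropLast]; omega

/-- The rounding defect, in `]0, 1]`, of the last step of `backCount`. -/
noncomputable def defect {d : ℕ} (lam v : List (Fin d) → ℝ) (w : List (Fin d)) (Y : ℤ) : ℝ :=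
  ((backCount lam v w.dropLast Y : ℝ) + 1 / 2 - v w) / lam w - backCount lam v w Y

section Words

variable {d : ℕ}

theorem ancestor_succ (m : ℕ) (w : List (Fin d)) :
    ancestor (m + 1) w = (ancestor m w).dropLast := Function.iterate_succ_apply' _ _ _

theorem length_ancestor (m : ℕ) (w : List (Fin d)) : (ancestor m w).length = w.length - m := by
  induction m with
  | zero => rfl
  | succ m ih => rw [ancestor_succ, List.length_dropLast, ih]; omega

theorem ancestor_length (w : List (Fin d)) : ancestor w.length w = [] := by
  rw [← List.length_eq_zero_iff, length_ancestor, Nat.sub_self]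

theorem ancestor_ne_nil {m : ℕ} {w : List (Fin d)} (h : m < w.length) : ancestor m w ≠ [] := by
  rw [← List.length_pos_iff, length_ancestor]; omega

/-- Induction on a word by erasing its last letter. -/
theorem dropLast_induction {motive : List (Fin d) → Prop} (nil : motive [])
    (step : ∀ w, w ≠ [] → motive w.dropLast → motive w) (w : List (Fin d)) : motive w := by
  induction w using List.reverseRecOn with
  | nil => exact nil
  | append_singleton l a ih => exact step _ (by simp) (by simpa using ih)

theorem length_eq_dropLast_succ {w : List (Fin d)} (hw : w ≠ []) :
    w.length = w.dropLast.length + 1 := by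
  have := List.length_pos_iff.2 hw
  rw [List.length_dropLast]; omega

variable {lam v : List (Fin d) → ℝ} {k : ℕ}

theorem prodMult_nil : prodMult lam [] = 1 := by simp [prodMult]

theorem prodMult_eq {w : List (Fin d)} (hw : w ≠ []) :
    prodMult lam w = lam w * prodMult lam w.dropLast := by
  unfold prodMult
  rw [length_eq_dropLast_succ hw, Finset.prod_range_succ', mul_comm]
  rfl

theorem Expanding.one_le_prodMult (h : Expanding k lam) (w : List (Fin d)) (hk : w.length ≤ k) :
    1 ≤ prodMult lam w := by
  induction w using dropLast_induction with
  | nil => rw [prodMult_nil]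
  | step w hw ih =>
    have h1 := length_eq_dropLast_succ hw
    rw [prodMult_eq hw]
    nlinarith [h w hw hk, ih (by omega)]

theorem Expanding.one_lt_prodMult (h : Expanding k lam) {w : List (Fin d)} (hw : w ≠ [])
    (hk : w.length ≤ k) : 1 < prodMult lam w := by
  have h1 := length_eq_dropLast_succ hw
  rw [prodMult_eq hw]
  nlinarith [h w hw hk, h.one_le_prodMult w.dropLast (by omega)]

theorem Expanding.prodMult_ancestor_le (h : Expanding k lam) (m : ℕ) (w : List (Fin d))
    (hk : w.length ≤ k) : prodMult lam (ancestor m w) ≤ prodMult lam w := by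
  induction m with
  | zero => exact le_rfl
  | succ m ih =>
    refine le_trans ?_ ih
    rw [ancestor_succ]
    by_cases hw : ancestor m w = []
    · rw [hw]; rfl
    · have h2 := length_ancestor m w
      have h3 := length_eq_dropLast_succ hw
      rw [prodMult_eq hw]
      nlinarith [h _ hw (by omega), h.one_le_prodMult (ancestor m w).dropLast (by omega)]

theorem backCount_nil (Y : ℤ) : backCount lam v [] Y = Y := by rw [backCount]; simp

theorem backCount_of_ne {w : List (Fin d)} (hw : w ≠ []) (Y : ℤ) :
    backCount lam v w Y = ⌈((backCount lam v w.dropLast Y : ℝ) + 1 / 2 - v w) / lam w⌉ - 1 := by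
  rw [backCount, if_neg hw]

/-- The integer `a` with `x - a ∈ ]0, 1]` is `⌈x⌉ - 1`. -/
theorem ceil_sub_one_eq_iff {x : ℝ} {a : ℤ} : ⌈x⌉ - 1 = a ↔ 0 < x - a ∧ x - a ≤ 1 := by
  rw [sub_eq_iff_eq_add, Int.ceil_eq_iff]
  push_cast
  constructor <;> rintro ⟨h1, h2⟩ <;> constructor <;> linarith

theorem backCount_eq_iff {w : List (Fin d)} (hw : w ≠ []) (Y a : ℤ) :
    backCount lam v w Y = a ↔
      0 < ((backCount lam v w.dropLast Y : ℝ) + 1 / 2 - v w) / lam w - a ∧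
        ((backCount lam v w.dropLast Y : ℝ) + 1 / 2 - v w) / lam w - a ≤ 1 := by
  rw [backCount_of_ne hw, ceil_sub_one_eq_iff]

theorem defect_mem {w : List (Fin d)} (hw : w ≠ []) (Y : ℤ) :
    0 < defect lam v w Y ∧ defect lam v w Y ≤ 1 := (backCount_eq_iff hw Y _).1 rfl

theorem lam_mul_defect {w : List (Fin d)} (hlam : lam w ≠ 0) (Y : ℤ) :
    lam w * defect lam v w Y - 1 / 2 =
      backCount lam v w.dropLast Y - affineMap lam v w (backCount lam v w Y) := by
  unfold defect affineMap
  field_simp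
  ring

theorem discretization_le_iff {w : List (Fin d)} (hlam : 0 < lam w) (x Y : ℤ) :
    discretization (affineMap lam v w) x ≤ Y ↔ x ≤ ⌈((Y : ℝ) + 1 / 2 - v w) / lam w⌉ - 1 := by
  unfold discretization affineMap
  rw [round_eq, ← Int.lt_add_one_iff, Int.floor_lt, Int.le_sub_one_iff, Int.lt_ceil,
    lt_div_iff₀ hlam]
  push_cast
  constructor <;> intro h <;> linarith

/-- An expanding affine map has an injective discretization. -/
theorem discretization_strictMono {w : List (Fin d)} (hlam : 1 < lam w) :
    StrictMono (discretization (affineMap lam v w)) := by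
  apply strictMono_int_of_lt_succ
  intro x
  unfold discretization affineMap
  rw [round_eq, round_eq, Int.floor_lt]
  have := Int.sub_one_lt_floor (lam w * ((x + 1 : ℤ) : ℝ) + v w + 1 / 2)
  push_cast at this ⊢
  linarith

theorem discOrbit_le_iff (h : Expanding k lam) {w : List (Fin d)} (hk : w.length ≤ k) (x Y : ℤ) :
    ∀ m ≤ w.length,
      (discOrbit lam v w m x ≤ backCount lam v (ancestor m w) Y ↔ x ≤ backCount lam v w Y) := by
  intro m hm
  induction m with
  | zero => exact Iff.rfl
  | succ m ih =>
    have hne := ancestor_ne_nil (w := w) (m := m) (by omega)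
    rw [← ih (by omega), discOrbit, ancestor_succ, backCount_of_ne hne,
      discretization_le_iff (one_pos.trans (h _ hne (by rw [length_ancestor]; omega)))]

theorem discOrbit_length_le_iff (h : Expanding k lam) {w : List (Fin d)} (hk : w.length ≤ k)
    (x Y : ℤ) : discOrbit lam v w w.length x ≤ Y ↔ x ≤ backCount lam v w Y := by
  rw [← discOrbit_le_iff h hk x Y _ le_rfl, ancestor_length, backCount_nil]

theorem discOrbit_strictMono (h : Expanding k lam) {w : List (Fin d)} (hk : w.length ≤ k) :
    ∀ m ≤ w.length, StrictMono (discOrbit lam v w m) := by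
  intro m hm
  induction m with
  | zero => exact strictMono_id
  | succ m ih =>
    have hne := ancestor_ne_nil (w := w) (m := m) (by omega)
    exact (discretization_strictMono (h _ hne (by rw [length_ancestor]; omega))).comp
      (ih (by omega))

/-- If an integer is mapped exactly to `Y`, its orbit is the backward count of `Y`. -/
theorem discOrbit_eq_backCount (h : Expanding k lam) {w : List (Fin d)} (hk : w.length ≤ k)
    {x Y : ℤ} (hx : discOrbit lam v w w.length x = Y) :
    ∀ m ≤ w.length, discOrbit lam v w m x = backCount lam v (ancestor m w) Y := by
  intro m hm
  induction hm using Nat.decreasingInduction with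
  | self => rw [hx, ancestor_length, backCount_nil]
  | of_succ m hm ih =>
    have hne := ancestor_ne_nil (w := w) (m := m) (by omega)
    have hl := h _ hne (by rw [length_ancestor]; omega)
    rw [backCount_of_ne hne, ← ancestor_succ, ← ih, discOrbit]
    apply le_antisymm
    · rw [← discretization_le_iff (one_pos.trans hl)]
    · rw [← (discretization_strictMono hl).le_iff_le, discretization_le_iff (one_pos.trans hl)]

theorem Expanding.abs_lam_mul_defect_le (h : Expanding k lam) {ε : ℝ} {Y : ℤ}
    (hY : HasSmallErrors k lam v ε Y) (i : Leaf d k) {m : ℕ} (hm : m < k) :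
    |lam (ancestor m i.toList) * defect lam v (ancestor m i.toList) Y - 1 / 2| ≤ ε := by
  obtain ⟨x, hx⟩ := hY
  have hi : i.toList.length = k := i.toList_length
  have hne := ancestor_ne_nil (w := i.toList) (m := m) (by omega)
  have hl := h _ hne (by rw [length_ancestor]; omega)
  have hx1 : discOrbit lam v i.toList i.toList.length (x i) = Y := by
    rw [hi]; exact ((hx i).1 _).2 rfl
  have h1 := (hx i).2 m hm
  unfold roundoffError at h1
  rw [discOrbit_eq_backCount h hi.le hx1 _ (by omega),
    discOrbit_eq_backCount h hi.le hx1 _ (by omega), ancestor_succ] at h1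
  rwa [lam_mul_defect (by linarith)]

theorem HasSmallErrors.exists_unique_preimage {ε : ℝ} {Y : ℤ}
    (hY : HasSmallErrors k lam v ε Y) (i : Leaf d k) :
    ∃ x : ℤ, ∀ z, discOrbit lam v i.toList k z = Y ↔ z = x := by
  obtain ⟨x, hx⟩ := hY
  exact ⟨x i, (hx i).1⟩

/-- A defect close to `1 / (2 lam w)` means that the last step of the backward count is exact up to a
small error, so small errors can be read off from the defects. -/
theorem hasSmallErrors_of_defect (h : Expanding k lam) {ε : ℝ} {Y : ℤ}
    (hY : ∀ w : List (Fin d), w ≠ [] → w.length ≤ k →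
      |lam w * defect lam v w Y - 1 / 2| ≤ min ε (1 / 4)) :
    HasSmallErrors k lam v ε Y := by
  refine ⟨fun i => backCount lam v i.toList Y, fun i => ?_⟩
  have hi : i.toList.length = k := i.toList_length
  have horb : ∀ m ≤ k, discOrbit lam v i.toList m (backCount lam v i.toList Y) =
      backCount lam v (ancestor m i.toList) Y := by
    intro m hm
    induction m with
    | zero => rfl
    | succ m ih =>
      have hne := ancestor_ne_nil (w := i.toList) (m := m) (by omega)
      have hl : (ancestor m i.toList).length ≤ k := by rw [length_ancestor]; omega
      have h1 := (hY _ hne hl).trans (min_le_right _ _)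
      rw [lam_mul_defect (by linarith [h _ hne hl])] at h1
      rw [discOrbit, ih (by omega), discretization_eq_iff, ancestor_succ]
      rw [abs_le] at h1
      constructor <;> linarith
  have hroot : ancestor k i.toList = [] := by
    have := ancestor_length i.toList
    rwa [hi] at this
  refine ⟨fun z => ⟨fun hz => ?_, fun hz => ?_⟩, fun m hm => ?_⟩
  · apply (discOrbit_strictMono (v := v) h hi.le k hi.ge).injective
    rw [hz, horb k le_rfl, hroot, backCount_nil]
  · rw [hz, horb k le_rfl, hroot, backCount_nil]
  · have hne := ancestor_ne_nil (w := i.toList) (m := m) (by omega)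
    have hl : (ancestor m i.toList).length ≤ k := by rw [length_ancestor]; omega
    have h1 := (hY _ hne hl).trans (min_le_left _ _)
    rw [lam_mul_defect (by linarith [h _ hne hl])] at h1
    unfold roundoffError
    rwa [horb _ hm, horb _ hm.le, ancestor_succ]

/-- Up to bounded rounding defects, `backCount` is affine with slope the inverse product of the
multipliers. -/
theorem backCount_sub (h : Expanding k lam) (w : List (Fin d)) (hk : w.length ≤ k) (Y Y' : ℤ) :
    (backCount lam v w Y - backCount lam v w Y' : ℝ) = (Y - Y') / prodMult lam w -
      ∑ m ∈ Finset.range w.length, prodMult lam (ancestor m w) / prodMult lam w *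
        (defect lam v (ancestor m w) Y - defect lam v (ancestor m w) Y') := by
  induction w using dropLast_induction with
  | nil => simp [prodMult_nil, backCount_nil]
  | step w hw ih =>
    have h1 := length_eq_dropLast_succ hw
    have ih' := ih (by omega)
    have hp := h.one_le_prodMult w.dropLast (by omega)
    have hl := h w hw hk
    have hw0 : prodMult lam w ≠ 0 := by linarith [h.one_le_prodMult w hk]
    rw [h1, Finset.sum_range_succ']
    have e : (backCount lam v w Y - backCount lam v w Y' : ℝ) =
        (backCount lam v w.dropLast Y - backCount lam v w.dropLast Y' : ℝ) / lam w -
        (defect lam v w Y - defect lam v w Y') := by unfold defect; ring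
    have e0 : ancestor 0 w = w := rfl
    rw [e, ih', e0, div_self hw0, sub_div, Finset.sum_div, prodMult_eq hw]
    have e1 : ((Y : ℝ) - Y') / prodMult lam w.dropLast / lam w =
        (Y - Y') / (lam w * prodMult lam w.dropLast) := by rw [div_div, mul_comm]
    have e2 : ∀ m, ancestor (m + 1) w = ancestor m w.dropLast := fun m => rfl
    rw [e1, sub_sub, one_mul]
    simp_rw [e2]
    congr 2
    refine Finset.sum_congr rfl fun m _ => ?_
    field_simp

end Words

/-! ### The cumulated difference seen from an integer with small errors -/

section CumDiff

variable {d k : ℕ} {lam v : List (Fin d) → ℝ}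

theorem backCount_mono (h : Expanding k lam) {w : List (Fin d)} (hk : w.length ≤ k) :
    Monotone (backCount lam v w) := by
  intro Y Y' hY
  rw [← discOrbit_length_le_iff h hk]
  exact ((discOrbit_length_le_iff h hk _ _).2 le_rfl).trans hY

theorem translateNeg_imageMeasure_real (y : ℝ) {S : Set ℝ} (hS : MeasurableSet S)
    (F : Leaf d k → Finset ℤ)
    (hF : ∀ i z, ((discOrbit lam v i.toList k z : ℤ) : ℝ) - y ∈ S ↔ z ∈ F i) :
    (translateNeg (imageMeasure k lam v) y).real S = ∑ i, ((F i).card : ℝ) := by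
  have hmeas : Measurable fun t : ℝ => t - y := measurable_id.sub_const y
  have hpre : MeasurableSet ((fun t : ℝ => t - y) ⁻¹' S) := hmeas hS
  have h1 : ∀ i : Leaf d k, ∑' z : ℤ, Measure.dirac ((discOrbit lam v i.toList k z : ℤ) : ℝ)
      ((fun t : ℝ => t - y) ⁻¹' S) = (F i).card := by
    intro i
    rw [tsum_eq_sum (s := F i)]
    · rw [Finset.sum_congr rfl (g := fun _ => 1), Finset.sum_const, nsmul_eq_mul, mul_one]
      intro z hz
      have hz' : ((discOrbit lam v i.toList k z : ℤ) : ℝ) ∈ (fun t : ℝ => t - y) ⁻¹' S := (hF i z).2 hz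
      rw [Measure.dirac_apply' _ hpre, indicator_of_mem hz', Pi.one_apply]
    · intro z hz
      have hz' : ((discOrbit lam v i.toList k z : ℤ) : ℝ) ∉ (fun t : ℝ => t - y) ⁻¹' S :=
        fun hm => hz ((hF i z).1 hm)
      rw [Measure.dirac_apply' _ hpre, indicator_of_notMem hz']
  rw [Measure.real, translateNeg, Measure.map_apply hmeas hS, imageMeasure,
    Measure.sum_apply _ hpre, ENNReal.tsum_prod', tsum_fintype]
  simp_rw [h1]
  rw [ENNReal.toReal_sum (fun i _ => ENNReal.natCast_ne_top _)]
  simp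

/-- The ratio of the product of the multipliers at the `m`-th ancestor of a word to the one at the
word. -/
noncomputable def weight (lam : List (Fin d) → ℝ) (w : List (Fin d)) (m : ℕ) : ℝ :=
  prodMult lam (ancestor m w) / prodMult lam w

/-- The fluctuating part of the cumulated difference: a weighted sum of centred defects. -/
noncomputable def fluctuation (k : ℕ) (lam v : List (Fin d) → ℝ) (Y : ℤ) : ℝ :=
  ∑ i : Leaf d k, ∑ m ∈ Finset.range k,
    weight lam i.toList m * (defect lam v (ancestor m i.toList) Y - 1 / 2)

/-- The constant part of the cumulated difference, due to the roundoff errors at the base point. -/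
noncomputable def bias (k : ℕ) (lam v : List (Fin d) → ℝ) (y : ℤ) : ℝ :=
  ∑ i : Leaf d k, ∑ m ∈ Finset.range k, weight lam i.toList (m + 1) *
    (lam (ancestor m i.toList) * defect lam v (ancestor m i.toList) y - 1 / 2)

theorem weight_nonneg (h : Expanding k lam) {w : List (Fin d)} (hk : w.length ≤ k) (m : ℕ) :
    0 ≤ weight lam w m :=
  div_nonneg (zero_le_one.trans (h.one_le_prodMult _ (by rw [length_ancestor]; omega)))
    (zero_le_one.trans (h.one_le_prodMult _ hk))

theorem weight_le_one (h : Expanding k lam) {w : List (Fin d)} (hk : w.length ≤ k) (m : ℕ) :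
    weight lam w m ≤ 1 :=
  div_le_one_of_le₀ (h.prodMult_ancestor_le m w hk) (zero_le_one.trans (h.one_le_prodMult _ hk))

theorem weight_succ_mul {w : List (Fin d)} {m : ℕ}
    (hm : m < w.length) : weight lam w (m + 1) * lam (ancestor m w) = weight lam w m := by
  rw [weight, weight, ancestor_succ, prodMult_eq (ancestor_ne_nil hm)]
  ring

theorem totalMult_inv : (totalMult k lam)⁻¹ = ∑ i : Leaf d k, (prodMult lam i.toList)⁻¹ := by
  rw [totalMult, inv_inv]

theorem totalMult_inv_nonneg (h : Expanding k lam) : 0 ≤ (totalMult k lam)⁻¹ := by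
  rw [totalMult_inv]
  exact Finset.sum_nonneg fun i _ => inv_nonneg.2
    (zero_le_one.trans (h.one_le_prodMult _ i.toList_length.le))

theorem totalMult_inv_le (h : Expanding k lam) : (totalMult k lam)⁻¹ ≤ d ^ k := by
  rw [totalMult_inv]
  calc _ ≤ ∑ i : Leaf d k, (1 : ℝ) := Finset.sum_le_sum fun i _ =>
        inv_le_one_of_one_le₀ (h.one_le_prodMult _ i.toList_length.le)
    _ = _ := by simp

theorem abs_double_sum_le {f : Leaf d k → ℕ → ℝ} {c : ℝ}
    (hf : ∀ i, ∀ m < k, |f i m| ≤ c) :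
    |∑ i : Leaf d k, ∑ m ∈ Finset.range k, f i m| ≤ k * d ^ k * c := by
  refine (Finset.abs_sum_le_sum_abs _ _).trans ?_
  calc _ ≤ ∑ i : Leaf d k, (k * c : ℝ) := by
        refine Finset.sum_le_sum fun i _ => (Finset.abs_sum_le_sum_abs _ _).trans ?_
        simpa using Finset.sum_le_card_nsmul _ _ _ fun m hm => hf i m (Finset.mem_range.1 hm)
    _ = _ := by simp; ring

theorem abs_fluctuation_le (h : Expanding k lam) (Y : ℤ) :
    |fluctuation k lam v Y| ≤ k * d ^ k := by
  refine (abs_double_sum_le (c := 1) fun i m hm => ?_).trans_eq (mul_one _)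
  have h0 := weight_nonneg h i.toList_length.le m
  have h1 := weight_le_one h i.toList_length.le m
  have h2 := defect_mem (lam := lam) (v := v)
    (ancestor_ne_nil (w := i.toList) (m := m) (by simpa using hm)) Y
  rw [abs_mul, abs_of_nonneg h0]
  have h3 : |defect lam v (ancestor m i.toList) Y - 1 / 2| ≤ 1 := by
    rw [abs_le]; constructor <;> linarith
  nlinarith [abs_nonneg (defect lam v (ancestor m i.toList) Y - 1 / 2)]

theorem abs_bias_le (h : Expanding k lam) {ε : ℝ} {y : ℤ} (hy : HasSmallErrors k lam v ε y) :
    |bias k lam v y| ≤ k * d ^ k * ε := by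
  refine abs_double_sum_le fun i m hm => ?_
  have h0 := weight_nonneg h i.toList_length.le (m + 1)
  have h1 := weight_le_one h i.toList_length.le (m + 1)
  have h2 := h.abs_lam_mul_defect_le hy i hm
  rw [abs_mul, abs_of_nonneg h0]
  exact (mul_le_of_le_one_left (abs_nonneg _) h1).trans h2

theorem backCount_sub_leaf (h : Expanding k lam) (i : Leaf d k) (y j : ℤ) (t : ℝ) :
    (backCount lam v i.toList (y + j) - backCount lam v i.toList y : ℝ) + 1 / 2
      - t * (prodMult lam i.toList)⁻¹ =
    -((t - j - 1 / 2) * (prodMult lam i.toList)⁻¹)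
    - ∑ m ∈ Finset.range k,
        weight lam i.toList m * (defect lam v (ancestor m i.toList) (y + j) - 1 / 2)
    + ∑ m ∈ Finset.range k, weight lam i.toList (m + 1) *
        (lam (ancestor m i.toList) * defect lam v (ancestor m i.toList) y - 1 / 2) := by
  have hi : i.toList.length = k := i.toList_length
  have h1 := backCount_sub (v := v) h i.toList hi.le (y + j) y
  rw [hi] at h1
  have htel := Finset.sum_range_sub' (fun m => weight lam i.toList m) k
  have hw0 : weight lam i.toList 0 = 1 :=
    div_self (zero_lt_one.trans_le (h.one_le_prodMult i.toList hi.le)).ne'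
  have hwk : weight lam i.toList k = (prodMult lam i.toList)⁻¹ := by
    have hroot := ancestor_length i.toList
    rw [hi] at hroot
    rw [weight, hroot, prodMult_nil, one_div]
  simp only [hw0, hwk] at htel
  have hb : ∑ m ∈ Finset.range k, weight lam i.toList (m + 1) *
      (lam (ancestor m i.toList) * defect lam v (ancestor m i.toList) y - 1 / 2) =
      ∑ m ∈ Finset.range k, (weight lam i.toList m * defect lam v (ancestor m i.toList) y
        - 1 / 2 * weight lam i.toList (m + 1)) := by
    refine Finset.sum_congr rfl fun m hm => ?_
    rw [← weight_succ_mul (m := m) (by rw [hi]; exact Finset.mem_range.1 hm)]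
    ring
  rw [h1, hb]
  simp only [mul_sub, Finset.sum_sub_distrib, ← Finset.mul_sum, ← Finset.sum_mul] at htel ⊢
  simp only [weight] at htel ⊢
  push_cast
  rw [div_eq_mul_inv]
  linarith

/-- On each unit interval the cumulated difference is affine with slope `-1 / λ_tot`, and at the
middle of the interval it equals the bias minus the fluctuation. -/
theorem cumDiff_eq (h : Expanding k lam) {ε : ℝ} {y : ℤ} (hy : HasSmallErrors k lam v ε y)
    {t : ℝ} (ht : 0 ≤ t) :
    cumDiff (translateNeg (imageMeasure k lam v) y) (scaledLeb (totalMult k lam)⁻¹) t =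
      -((totalMult k lam)⁻¹ * (Int.fract t - 1 / 2)) - fluctuation k lam v (y + ⌊t⌋)
        + bias k lam v y := by
  choose x hx using hy.exists_unique_preimage
  have h1 : (translateNeg (imageMeasure k lam v) y).real {0} = ∑ i : Leaf d k, (1 : ℝ) := by
    rw [translateNeg_imageMeasure_real y (measurableSet_singleton 0) (fun i => {x i})]
    · simp
    · intro i z
      rw [mem_singleton_iff, Finset.mem_singleton, ← hx i z, sub_eq_zero, Int.cast_inj]
  have h2 : (translateNeg (imageMeasure k lam v) y).real (Ioc 0 t) =
      ∑ i : Leaf d k, (backCount lam v i.toList (y + ⌊t⌋) - backCount lam v i.toList y : ℝ) := by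
    rw [translateNeg_imageMeasure_real y measurableSet_Ioc
      (fun i => Finset.Ioc (backCount lam v i.toList y) (backCount lam v i.toList (y + ⌊t⌋)))]
    · refine Finset.sum_congr rfl fun i _ => ?_
      have hm : backCount lam v i.toList y ≤ backCount lam v i.toList (y + ⌊t⌋) :=
        backCount_mono h i.toList_length.le (by linarith [Int.floor_nonneg.2 ht])
      rw [Int.card_Ioc]
      have : (((backCount lam v i.toList (y + ⌊t⌋) - backCount lam v i.toList y).toNat : ℤ) : ℝ) =
        ((backCount lam v i.toList (y + ⌊t⌋) - backCount lam v i.toList y : ℤ) : ℝ) := by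
        rw [Int.toNat_of_nonneg (by linarith)]
      push_cast at this
      exact this
    · intro i z
      have hg := fun Y => discOrbit_length_le_iff (v := v) h i.toList_length.le z Y
      have hi : i.toList.length = k := i.toList_length
      rw [hi] at hg
      rw [Finset.mem_Ioc, ← hg, ← not_le, ← hg, mem_Ioc, not_le, sub_pos, Int.cast_lt,
        sub_le_iff_le_add']
      have : ((discOrbit lam v i.toList k z : ℤ) : ℝ) ≤ y + t ↔
          discOrbit lam v i.toList k z ≤ y + ⌊t⌋ := by
        rw [← sub_le_iff_le_add' (a := discOrbit lam v i.toList k z), Int.le_floor]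
        push_cast
        rw [sub_le_iff_le_add']
      rw [this]
  have h3 : (scaledLeb (totalMult k lam)⁻¹).real {0} = 0 := by
    simp [scaledLeb, Measure.real]
  have h4 : (scaledLeb (totalMult k lam)⁻¹).real (Ioc 0 t) = (totalMult k lam)⁻¹ * t := by
    rw [scaledLeb, measureReal_ennreal_smul_apply, Real.volume_real_Ioc_of_le ht,
      ENNReal.toReal_ofReal (totalMult_inv_nonneg h), sub_zero]
  have h5 := Finset.sum_congr rfl fun i (_ : i ∈ (Finset.univ : Finset (Leaf d k))) =>
    backCount_sub_leaf (v := v) h i y ⌊t⌋ t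
  simp only [Finset.sum_add_distrib, Finset.sum_sub_distrib, ← Finset.mul_sum,
    Finset.sum_neg_distrib] at h5
  rw [cumDiff, h1, h2, h3, h4, fluctuation, bias, totalMult_inv, Int.fract]
  simp only [Finset.sum_sub_distrib]
  have h6 : ∑ i : Leaf d k, (1 / 2 : ℝ) = 1 / 2 * ∑ i : Leaf d k, (1 : ℝ) := by
    rw [Finset.mul_sum, mul_one]
  rw [h6] at h5
  linarith

end CumDiff

/-! ### Averages over shifted windows -/

theorem abs_sum_shift_sub_le {f : ℤ → ℝ} {B : ℝ} (hf : ∀ Y, |f Y| ≤ B) (y : ℤ) (n h : ℕ) :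
    |∑ t ∈ Finset.range n, f (y + t + h) - ∑ t ∈ Finset.range n, f (y + t)| ≤ 2 * B * h := by
  induction h with
  | zero => simp
  | succ h ih =>
    have h1 := Finset.sum_range_sub (fun t : ℕ => f (y + t + h)) n
    rw [Finset.sum_sub_distrib] at h1
    have h2 : ∀ t : ℕ, y + (t + 1 : ℕ) + (h : ℤ) = y + t + (h + 1 : ℕ) := fun t => by push_cast; ring
    simp only [h2] at h1
    have h3 := hf (y + n + h)
    have h4 := hf (y + (0 : ℕ) + h)
    push_cast at h1 h3 h4 ih ⊢
    rw [abs_le] at *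
    constructor <;> linarith

/-- If, outside an exceptional set, the average of `f` over finitely many shifts is close to `c`, then
so is its average over long windows. -/
theorem abs_sum_sub_le_of_shifts {f : ℤ → ℝ} {B c ε : ℝ} (hf : ∀ Y, |f Y| ≤ B) (hc : |c| ≤ B)
    {Q H : ℕ} (hQ : 0 < Q) {h : ℕ → ℕ} (hh : ∀ j < Q, h j ≤ H) (hε : 0 ≤ ε) (p : ℤ → Prop)
    [DecidablePred p]
    (hgood : ∀ Y, p Y → |∑ j ∈ Finset.range Q, f (Y + h j) - Q * c| ≤ Q * ε) (y : ℤ) (n : ℕ) :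
    |∑ t ∈ Finset.range n, f (y + t) - n * c| ≤
      n * ε + 2 * B * ∑ t ∈ Finset.range n, (if p (y + t) then 0 else 1) + 2 * B * H := by
  have hQ' : (0 : ℝ) < Q := by exact_mod_cast hQ
  have hB : 0 ≤ B := (abs_nonneg _).trans hc
  have h1 : ∀ Y, |∑ j ∈ Finset.range Q, f (Y + h j) - Q * c| ≤
      Q * (ε + 2 * B * (if p Y then 0 else 1)) := by
    intro Y
    split_ifs with hp
    · simpa using hgood Y hp
    · have : |∑ j ∈ Finset.range Q, f (Y + h j)| ≤ Q * B := by
        refine (Finset.abs_sum_le_sum_abs _ _).trans ?_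
        simpa using Finset.sum_le_card_nsmul _ _ _ fun j (_ : j ∈ Finset.range Q) => hf (Y + h j)
      have h2 := abs_sub (∑ j ∈ Finset.range Q, f (Y + h j)) (Q * c)
      rw [abs_mul, abs_of_pos hQ'] at h2
      nlinarith
  have h2 : |∑ t ∈ Finset.range n, ∑ j ∈ Finset.range Q, f (y + t + h j) - n * (Q * c)| ≤
      Q * (n * ε + 2 * B * ∑ t ∈ Finset.range n, (if p (y + t) then 0 else 1)) := by
    have e1 : (n : ℝ) * (Q * c) = ∑ t ∈ Finset.range n, (Q * c) := by simp
    have e2 : (n : ℝ) * ε = ∑ t ∈ Finset.range n, ε := by simp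
    rw [e1, e2, ← Finset.sum_sub_distrib, Finset.mul_sum, ← Finset.sum_add_distrib, Finset.mul_sum]
    exact (Finset.abs_sum_le_sum_abs _ _).trans (Finset.sum_le_sum fun t _ => h1 _)
  have h3 : |∑ t ∈ Finset.range n, ∑ j ∈ Finset.range Q, f (y + t + h j) -
      Q * ∑ t ∈ Finset.range n, f (y + t)| ≤ Q * (2 * B * H) := by
    rw [Finset.sum_comm]
    have e1 : (Q : ℝ) * ∑ t ∈ Finset.range n, f (y + t) =
      ∑ j ∈ Finset.range Q, ∑ t ∈ Finset.range n, f (y + t) := by simp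
    have e2 : (Q : ℝ) * (2 * B * H) = ∑ j ∈ Finset.range Q, (2 * B * H) := by simp
    rw [e1, e2, ← Finset.sum_sub_distrib]
    refine (Finset.abs_sum_le_sum_abs _ _).trans (Finset.sum_le_sum fun j hj => ?_)
    refine (abs_sum_shift_sub_le hf y n (h j)).trans ?_
    have : (h j : ℝ) ≤ H := by exact_mod_cast hh j (Finset.mem_range.1 hj)
    gcongr
  have h4 : |Q * (∑ t ∈ Finset.range n, f (y + t) - n * c)| ≤
      Q * (n * ε + 2 * B * ∑ t ∈ Finset.range n, (if p (y + t) then 0 else 1) + 2 * B * H) := by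
    rw [abs_le] at *
    constructor <;> nlinarith
  rw [abs_mul, abs_of_pos hQ'] at h4
  exact le_of_mul_le_mul_left h4 hQ'

/-- The points `x_j ∈ ]0, 1]` are, modulo `1` and up to small errors, a coset of `(1 / Q) ℤ / ℤ`; then
the sum over `j` of a function with mean zero on the circle is bounded. The mean zero condition is
encoded by a primitive `P` with `P 0 = P 1`. -/
theorem abs_sum_le_of_cyclic {P φ : ℝ → ℝ} (hP01 : P 0 = P 1)
    (hP : ∀ x x' : ℝ, 0 ≤ x → x ≤ 1 → 0 ≤ x' → x' ≤ 1 →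
      |P x' - P x - φ x * (x' - x)| ≤ (x' - x) ^ 2)
    (hφ : ∀ x : ℝ, 0 ≤ x → x ≤ 1 → |φ x| ≤ 1 / 2)
    {Q : ℕ} (hQ : 4 ≤ Q) {κ : ℝ} (hκ : 16 * κ * Q ^ 2 ≤ 1) {x : ℕ → ℝ} {b : ℕ → ℤ} {x₀ : ℝ}
    (hx : ∀ j ≤ Q, 0 < x j ∧ x j ≤ 1) (hxQ : x Q = x 0)
    (hb : ∀ j ≤ Q, |x j - x₀ - j / Q - b j| ≤ 2 * κ) :
    |∑ j ∈ Finset.range Q, φ (x j)| ≤ 12 := by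
  have hQ4 : (4 : ℝ) ≤ Q := by exact_mod_cast hQ
  have hQ' : (0 : ℝ) < Q := by linarith
  obtain ⟨s, hs⟩ : ∃ s : ℝ, s = 1 / Q := ⟨_, rfl⟩
  have hsQ : s * Q = 1 := by rw [hs]; field_simp
  have hs0 : 0 < s := by rw [hs]; positivity
  have hs4 : s ≤ 1 / 4 := by nlinarith
  have hκs : 4 * κ ≤ s ^ 2 / 4 := by
    have : 16 * κ * Q ^ 2 * s ^ 2 ≤ 1 * s ^ 2 := by gcongr
    have e : 16 * κ * Q ^ 2 * s ^ 2 = 16 * κ * (s * Q) ^ 2 := by ring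
    rw [e, hsQ] at this
    linarith
  have hstep : ∀ j ∈ Finset.range Q,
      |x (j + 1) - x j - s - (b (j + 1) - b j : ℤ)| ≤ s ^ 2 / 4 := by
    intro j hj
    have hj' := Finset.mem_range.1 hj
    have h1 := hb j hj'.le
    have h2 := hb (j + 1) hj'
    have e : ((j + 1 : ℕ) : ℝ) / Q = j / Q + s := by rw [hs]; push_cast; ring
    rw [e] at h2
    push_cast
    rw [abs_le] at *
    constructor <;> linarith
  have hlip : ∀ x x' : ℝ, 0 ≤ x → x ≤ 1 → 0 ≤ x' → x' ≤ 1 → |P x' - P x| ≤ 3 / 2 * |x' - x| := by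
    intro x x' h0 h1 h0' h1'
    have e1 := hP x x' h0 h1 h0' h1'
    have e2 := hφ x h0 h1
    have e3 : |φ x * (x' - x)| ≤ 1 / 2 * |x' - x| := by rw [abs_mul]; gcongr
    have e4 : (x' - x) ^ 2 ≤ |x' - x| := by
      rw [← sq_abs]
      have : |x' - x| ≤ 1 := by rw [abs_le]; constructor <;> linarith
      nlinarith [abs_nonneg (x' - x)]
    have e5 : P x' - P x = (P x' - P x - φ x * (x' - x)) + φ x * (x' - x) := by ring
    rw [e5]
    refine (abs_add_le _ _).trans ?_
    linarith
  have hmain : ∀ j ∈ Finset.range Q,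
      |P (x (j + 1)) - P (x j) - s * φ (x j)| ≤
        5 * s ^ 2 + 7 * s * (-(b (j + 1) - b j : ℤ) : ℝ) := by
    intro j hj
    have hj' := Finset.mem_range.1 hj
    have h1 := abs_le.1 (hstep j hj)
    obtain ⟨h2, h3⟩ := hx j hj'.le
    obtain ⟨h4, h5⟩ := hx (j + 1) hj'
    have h6 := hφ (x j) h2.le h3
    have hss : s ^ 2 ≤ s / 4 := by nlinarith
    generalize b (j + 1) - b j = c at *
    have hc0 : c < 1 := by
      by_contra hc
      have : (1 : ℝ) ≤ c := by exact_mod_cast not_lt.1 hc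
      linarith [h1.1]
    have hc1 : -2 < c := by
      by_contra hc
      have : (c : ℝ) ≤ -2 := by exact_mod_cast not_lt.1 hc
      linarith [h1.2]
    obtain rfl | rfl : c = 0 ∨ c = -1 := by omega
    · have h7 := hP (x j) (x (j + 1)) h2.le h3 h4.le h5
      have h8 : |φ (x j) * (x (j + 1) - x j - s)| ≤ 1 / 2 * (s ^ 2 / 4) := by
        rw [abs_mul]
        have : |x (j + 1) - x j - s| ≤ s ^ 2 / 4 := by
          rw [abs_le]; push_cast at h1; constructor <;> linarith
        gcongr
      have h9 : (x (j + 1) - x j) ^ 2 ≤ (2 * s) ^ 2 := by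
        push_cast at h1
        apply sq_le_sq'
        · linarith
        · linarith
      have e : P (x (j + 1)) - P (x j) - s * φ (x j) =
        (P (x (j + 1)) - P (x j) - φ (x j) * (x (j + 1) - x j)) +
          φ (x j) * (x (j + 1) - x j - s) := by ring
      rw [e]
      refine (abs_add_le _ _).trans ?_
      push_cast
      nlinarith
    · push_cast at h1 ⊢
      have h7 := hlip 0 (x (j + 1)) le_rfl zero_le_one h4.le h5
      have h8 := hlip (x j) 1 h2.le h3 zero_le_one le_rfl
      rw [sub_zero, abs_of_pos h4] at h7
      rw [abs_of_nonneg (by linarith : 0 ≤ 1 - x j)] at h8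
      have h9 : |s * φ (x j)| ≤ s * (1 / 2) := by rw [abs_mul, abs_of_pos hs0]; gcongr
      rw [hP01] at h7
      have h10 : x (j + 1) ≤ 2 * s := by linarith
      have h11 : 1 - x j ≤ 2 * s := by linarith
      rw [abs_le] at *
      constructor <;> nlinarith
  have hbtel : (∑ j ∈ Finset.range Q, (b (j + 1) - b j) : ℤ) = -1 := by
    rw [Finset.sum_range_sub]
    have h1 := abs_le.1 (hb Q le_rfl)
    have h2 := abs_le.1 (hb 0 (Nat.zero_le _))
    rw [hxQ, div_self hQ'.ne'] at h1
    simp only [Nat.cast_zero, zero_div] at h2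
    have hss : s ^ 2 ≤ s / 4 := by nlinarith
    have h3 : ((b Q - b 0 : ℤ) : ℝ) < 0 := by push_cast; linarith
    have h4 : (-2 : ℝ) < ((b Q - b 0 : ℤ) : ℝ) := by push_cast; linarith
    have h3' : b Q - b 0 < 0 := by exact_mod_cast h3
    have h4' : -2 < b Q - b 0 := by exact_mod_cast h4
    omega
  have hsum : |∑ j ∈ Finset.range Q, (P (x (j + 1)) - P (x j) - s * φ (x j))| ≤ 12 * s := by
    refine (Finset.abs_sum_le_sum_abs _ _).trans ((Finset.sum_le_sum hmain).trans ?_)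
    have e1 : ∑ j ∈ Finset.range Q, 7 * s * (-(b (j + 1) - b j : ℤ) : ℝ) = 7 * s := by
      rw [← Finset.mul_sum, Finset.sum_neg_distrib, ← Int.cast_sum, hbtel]
      push_cast; ring
    rw [Finset.sum_add_distrib, e1]
    simp only [Finset.sum_const, Finset.card_range, nsmul_eq_mul]
    have : (Q : ℝ) * (5 * s ^ 2) = 5 * s * (s * Q) := by ring
    rw [this, hsQ]
    linarith
  rw [Finset.sum_sub_distrib, Finset.sum_range_sub (fun j => P (x j)), hxQ, sub_self, zero_sub,
    abs_neg, ← Finset.mul_sum, abs_mul, abs_of_pos hs0] at hsum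
  nlinarith

/-! ### Asymptotic independence of the defects -/

section Shifts

variable {d k : ℕ} {lam v : List (Fin d) → ℝ} {κ : ℝ}

/-- The translation by `h` moves the phase of the word `w` by `σ` and fixes the phases of the other
words, up to integers `a` and an error `κ`. The phase of `u` is the quotient by `prodMult lam u`. -/
def IsShift (k : ℕ) (lam : List (Fin d) → ℝ) (κ : ℝ) (w : List (Fin d)) (σ : ℝ) (h : ℕ)
    (a : List (Fin d) → ℤ) : Prop :=
  a [] = h ∧ ∀ u : List (Fin d), u ≠ [] → u.length ≤ k →
    |h * (prodMult lam u)⁻¹ - (if u = w then σ else 0) - a u| ≤ κ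

theorem exists_isShift {H : ℕ}
    (hret : HasReturns (fun w : Node d k => (prodMult lam w.1)⁻¹) κ H) (w : List (Fin d)) (σ : ℝ) :
    ∃ h : ℕ, h ≤ H ∧ ∃ a, IsShift k lam κ w σ h a := by
  obtain ⟨h, hH, a, ha⟩ := hret fun u => if u.1 = w then σ else 0
  refine ⟨h, hH, fun u => if hu : 1 ≤ u.length ∧ u.length ≤ k then a ⟨u, hu⟩ else h, ?_, ?_⟩
  · simp
  · intro u hu hk
    have hu' : 1 ≤ u.length ∧ u.length ≤ k := ⟨List.length_pos_iff.2 hu, hk⟩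
    simpa [dif_pos hu'] using ha ⟨u, hu'⟩

/-- None of the defects along the path from `w` to the root is within `2 κ` of the discontinuity. -/
def Regular (lam v : List (Fin d) → ℝ) (κ : ℝ) (w : List (Fin d)) (Y : ℤ) : Prop :=
  ∀ m < w.length, 2 * κ < defect lam v (ancestor m w) Y ∧
    defect lam v (ancestor m w) Y < 1 - 2 * κ

theorem regular_nil (Y : ℤ) : Regular lam v κ [] Y := fun m hm => by simp at hm

theorem forall_ancestor_iff {p : List (Fin d) → Prop} {w : List (Fin d)} (hw : w ≠ []) :
    (∀ m < w.length, p (ancestor m w)) ↔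
      p w ∧ ∀ m < w.dropLast.length, p (ancestor m w.dropLast) := by
  rw [length_eq_dropLast_succ hw]
  constructor
  · exact fun h => ⟨h 0 (Nat.succ_pos _), fun m hm => h (m + 1) (Nat.succ_lt_succ hm)⟩
  · rintro ⟨h0, h1⟩ (_ | m) hm
    · exact h0
    · exact h1 m (Nat.lt_of_succ_lt_succ hm)

theorem regular_iff {w : List (Fin d)} (hw : w ≠ []) (Y : ℤ) :
    Regular lam v κ w Y ↔ (2 * κ < defect lam v w Y ∧ defect lam v w Y < 1 - 2 * κ) ∧
      Regular lam v κ w.dropLast Y :=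
  forall_ancestor_iff (p := fun u => 2 * κ < defect lam v u Y ∧ defect lam v u Y < 1 - 2 * κ) hw

theorem ancestor_ne_of_length {u w : List (Fin d)} (hl : u.length ≤ w.length) (hne : u ≠ w) :
    ∀ m < u.length, ancestor m u ≠ w := by
  rintro (_ | m) hm h
  · exact hne h
  · have := congrArg List.length h
    rw [length_ancestor] at this
    omega

variable {w : List (Fin d)} {σ : ℝ} {h : ℕ} {a : List (Fin d) → ℤ}

theorem IsShift.residual_le (hs : IsShift k lam κ w σ h a) (hκ : 0 ≤ κ) {u : List (Fin d)}
    (hk : u.length ≤ k) (hu : ∀ m < u.length, ancestor m u ≠ w) :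
    |h * (prodMult lam u)⁻¹ - a u| ≤ κ := by
  by_cases hne : u = []
  · subst hne
    simpa [prodMult_nil, hs.1] using hκ
  · have h1 := hs.2 u hne hk
    have h0 : u ≠ w := hu 0 (List.length_pos_iff.2 hne)
    rwa [if_neg h0, sub_zero] at h1

theorem IsShift.quotient_le (hs : IsShift k lam κ w σ h a) (hlam : Expanding k lam) (hκ : 0 ≤ κ)
    {u : List (Fin d)} (hne : u ≠ []) (hk : u.length ≤ k)
    (hu : ∀ m < u.dropLast.length, ancestor m u.dropLast ≠ w) :
    |a u.dropLast / lam u - (if u = w then σ else 0) - a u| ≤ 2 * κ := by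
  have hl := length_eq_dropLast_succ hne
  have h1 := hs.residual_le hκ (by omega) hu
  have h2 := hs.2 u hne hk
  have hlu := hlam u hne hk
  have h3 : |(h * (prodMult lam u.dropLast)⁻¹ - a u.dropLast) / lam u| ≤ κ := by
    rw [abs_div, abs_of_pos (by linarith : 0 < lam u)]
    exact (div_le_self (abs_nonneg _) hlu.le).trans h1
  have e : a u.dropLast / lam u - (if u = w then σ else 0) - a u =
      (h * (prodMult lam u)⁻¹ - (if u = w then σ else 0) - a u) -
        (h * (prodMult lam u.dropLast)⁻¹ - a u.dropLast) / lam u := by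
    rw [prodMult_eq hne, mul_inv]
    ring
  rw [e]
  refine (abs_sub _ _).trans ?_
  linarith

/-- If the path of `u` avoids the shifted word and `Y` is regular for `u`, no rounding on the path wraps
around: the backward count increases by exactly the integer `a u`. -/
theorem IsShift.backCount_add (hs : IsShift k lam κ w σ h a) (hlam : Expanding k lam) (hκ : 0 ≤ κ)
    {Y : ℤ} (u : List (Fin d)) (hk : u.length ≤ k) (hu : ∀ m < u.length, ancestor m u ≠ w)
    (hr : Regular lam v κ u Y) : backCount lam v u (Y + h) = backCount lam v u Y + a u := by
  induction u using dropLast_induction with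
  | nil => rw [backCount_nil, backCount_nil, hs.1]
  | step u hne ih =>
    have hl := length_eq_dropLast_succ hne
    rw [regular_iff hne] at hr
    rw [forall_ancestor_iff (p := fun u => u ≠ w) hne] at hu
    have hq := hs.quotient_le hlam hκ hne hk hu.2
    rw [if_neg hu.1, sub_zero] at hq
    rw [backCount_eq_iff hne, ih (by omega) hu.2 hr.2]
    have e : (((backCount lam v u.dropLast Y + a u.dropLast : ℤ) : ℝ) + 1 / 2 - v u) / lam u -
        ((backCount lam v u Y + a u : ℤ) : ℝ) =
        defect lam v u Y + (a u.dropLast / lam u - a u) := by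
      unfold defect; push_cast; ring
    rw [e]
    rw [abs_le] at hq
    constructor <;> linarith [hr.1.1, hr.1.2]

theorem IsShift.defect_add_sub_le (hs : IsShift k lam κ w σ h a) (hlam : Expanding k lam)
    (hκ : 0 ≤ κ) {Y : ℤ} {u : List (Fin d)} (hne : u ≠ []) (hk : u.length ≤ k)
    (hu : ∀ m < u.length, ancestor m u ≠ w) (hr : Regular lam v κ u Y) :
    |defect lam v u (Y + h) - defect lam v u Y| ≤ 2 * κ := by
  have hl := length_eq_dropLast_succ hne
  have h1 := hs.backCount_add hlam hκ u hk hu hr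
  rw [regular_iff hne] at hr
  rw [forall_ancestor_iff (p := fun u => u ≠ w) hne] at hu
  have h2 := hs.backCount_add hlam hκ u.dropLast (by omega) hu.2 hr.2
  have hq := hs.quotient_le hlam hκ hne hk hu.2
  rw [if_neg hu.1, sub_zero] at hq
  have e : defect lam v u (Y + h) - defect lam v u Y = a u.dropLast / lam u - a u := by
    unfold defect; rw [h1, h2]; push_cast; ring
  rwa [e]

/-- The defect of the shifted word itself moves by `σ` modulo `1`; only the proper ancestors have to be
regular. -/
theorem IsShift.exists_defect_add_sub_le (hs : IsShift k lam κ w σ h a) (hlam : Expanding k lam)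
    (hκ : 0 ≤ κ) {Y : ℤ} (hne : w ≠ []) (hk : w.length ≤ k) (hr : Regular lam v κ w.dropLast Y) :
    ∃ b : ℤ, |defect lam v w (Y + h) - defect lam v w Y - σ - b| ≤ 2 * κ := by
  have hl := length_eq_dropLast_succ hne
  have hu : ∀ m < w.dropLast.length, ancestor m w.dropLast ≠ w :=
    ancestor_ne_of_length (by omega) (fun h => by rw [h] at hl; omega)
  have h2 := hs.backCount_add hlam hκ w.dropLast (by omega) hu hr
  have hq := hs.quotient_le hlam hκ hne hk hu
  rw [if_pos rfl] at hq
  refine ⟨a w - (backCount lam v w (Y + h) - backCount lam v w Y), ?_⟩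
  have e : defect lam v w (Y + h) - defect lam v w Y - σ -
      ((a w - (backCount lam v w (Y + h) - backCount lam v w Y) : ℤ) : ℝ) =
      a w.dropLast / lam w - σ - a w := by
    unfold defect; rw [h2]; push_cast; ring
  rwa [e]

end Shifts

section Averages

variable {d k : ℕ} {lam v : List (Fin d) → ℝ} {κ : ℝ} {Q H : ℕ}

open Classical in
/-- The number of nonregular integers for `w` in the window of length `n` starting from `y`. -/
noncomputable def irregularCount (lam v : List (Fin d) → ℝ) (κ : ℝ) (w : List (Fin d)) (y : ℤ)
    (n : ℕ) : ℝ :=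
  ∑ t ∈ Finset.range n, (if Regular lam v κ w (y + t) then 0 else 1)

open Classical in
/-- The irregular integers are rare: for two distinct shifts of the last phase by multiples of `1 / Q`,
the last defect cannot be near the discontinuity at both shifted points. -/
theorem irregularCount_le (hlam : Expanding k lam) (hκ : 0 ≤ κ) (hQ : 0 < Q) (hκQ : 8 * κ * Q < 1)
    (hret : HasReturns (fun w : Node d k => (prodMult lam w.1)⁻¹) κ H)
    (y : ℤ) (n : ℕ) (w : List (Fin d)) (hk : w.length ≤ k) :
    irregularCount lam v κ w y n + (n * (1 / Q) + 2 * H) ≤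
      3 ^ w.length * (n * (1 / Q) + 2 * H) := by
  have hQ' : (0 : ℝ) < Q := by exact_mod_cast hQ
  induction w using dropLast_induction with
  | nil => simp [irregularCount, regular_nil]
  | step w hw ih =>
    have hl := length_eq_dropLast_succ hw
    have ih' := ih (by omega)
    choose h hH a hs using fun j : ℕ => exists_isShift hret w ((j : ℝ) / Q)
    set f : ℤ → ℝ := fun Y =>
      if 2 * κ < defect lam v w Y ∧ defect lam v w Y < 1 - 2 * κ then 0 else 1 with hf
    have hf0 : ∀ Y, 0 ≤ f Y := fun Y => by simp only [hf]; split_ifs <;> norm_num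
    have hf1 : ∀ Y, |f Y| ≤ 1 := fun Y => by simp only [hf]; split_ifs <;> norm_num
    have hgood : ∀ Y, Regular lam v κ w.dropLast Y →
        |∑ j ∈ Finset.range Q, f (Y + h j) - Q * 0| ≤ Q * (1 / Q) := by
      intro Y hY
      rw [mul_zero, sub_zero, abs_of_nonneg (Finset.sum_nonneg fun j _ => hf0 _),
        mul_one_div_cancel hQ'.ne']
      choose b hb using fun j => (hs j).exists_defect_add_sub_le hlam hκ hw hk hY
      have hnear : ∀ j, ¬(2 * κ < defect lam v w (Y + h j) ∧
          defect lam v w (Y + h j) < 1 - 2 * κ) →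
          ∃ c : ℤ, |defect lam v w Y + (j : ℝ) / Q - c| ≤ 4 * κ := by
        intro j hj
        have h1 := abs_le.1 (hb j)
        obtain ⟨h2, h3⟩ := defect_mem (lam := lam) (v := v) hw (Y + h j)
        by_cases hj2 : 2 * κ < defect lam v w (Y + h j)
        · refine ⟨1 - b j, ?_⟩
          have := not_lt.1 fun h4 => hj ⟨hj2, h4⟩
          push_cast
          rw [abs_le]; constructor <;> linarith
        · refine ⟨-b j, ?_⟩
          push_cast
          rw [abs_le]; constructor <;> linarith
      have : ∑ j ∈ Finset.range Q, f (Y + h j) =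
          ((Finset.range Q).filter fun j => ¬(2 * κ < defect lam v w (Y + h j) ∧
            defect lam v w (Y + h j) < 1 - 2 * κ)).card := by
        rw [Finset.card_filter]
        push_cast
        refine Finset.sum_congr rfl fun j _ => ?_
        simp only [hf, ite_not]
      rw [this]
      norm_cast
      rw [Finset.card_le_one]
      intro i hi j hj
      rw [Finset.mem_filter, Finset.mem_range] at hi hj
      obtain ⟨c, hc⟩ := hnear i hi.2
      obtain ⟨c', hc'⟩ := hnear j hj.2
      have h5 : |(((i : ℤ) - j - Q * (c - c') : ℤ) : ℝ)| < 1 := by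
        have e : (((i : ℤ) - j - Q * (c - c') : ℤ) : ℝ) =
            Q * ((defect lam v w Y + (i : ℝ) / Q - c) - (defect lam v w Y + (j : ℝ) / Q - c')) := by
          push_cast; field_simp; ring
        rw [e, abs_mul, abs_of_pos hQ']
        have h6 : |(defect lam v w Y + (i : ℝ) / Q - c) - (defect lam v w Y + (j : ℝ) / Q - c')| ≤
          8 * κ := (abs_sub _ _).trans (by linarith)
        calc _ ≤ (Q : ℝ) * (8 * κ) := by gcongr
          _ < 1 := by linarith
      have h7 : (i : ℤ) - j - Q * (c - c') = 0 := by
        rw [← Int.abs_lt_one_iff]; exact_mod_cast h5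
      have h8 : ((Q : ℤ)) ∣ i - j := ⟨c - c', by linarith⟩
      have h9 := Int.eq_zero_of_abs_lt_dvd h8 (by rw [abs_lt]; omega)
      omega
    have key := abs_sum_sub_le_of_shifts (B := 1) (c := 0) (ε := 1 / Q) hf1 (by simp) hQ
      (fun j _ => hH j) (by positivity) (fun Y => Regular lam v κ w.dropLast Y) hgood y n
    have hle : irregularCount lam v κ w y n ≤
        irregularCount lam v κ w.dropLast y n + ∑ t ∈ Finset.range n, f (y + t) := by
      unfold irregularCount
      rw [← Finset.sum_add_distrib]
      refine Finset.sum_le_sum fun t _ => ?_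
      have := hf0 (y + t)
      by_cases h1 : Regular lam v κ w.dropLast (y + t)
      · by_cases h2 : 2 * κ < defect lam v w (y + t) ∧ defect lam v w (y + t) < 1 - 2 * κ
        · rw [if_pos ((regular_iff hw _).2 ⟨h2, h1⟩), if_pos h1]; linarith
        · simp only [hf, if_neg h2, if_pos h1]; split_ifs <;> norm_num
      · rw [if_neg h1]
        split_ifs <;> linarith
    have hkey : ∑ t ∈ Finset.range n, f (y + t) ≤
        n * (1 / Q) + 2 * 1 * irregularCount lam v κ w.dropLast y n + 2 * 1 * H := by
      have := (abs_le.1 key).2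
      rwa [mul_zero, sub_zero] at this
    have hX : 0 ≤ (n : ℝ) * (1 / Q) + 2 * H := by positivity
    rw [hl, pow_succ]
    linarith

open Classical in
/-- A function of the last defect, with mean zero on the circle, times a factor which does not see the
last phase, has small averages over long windows. -/
theorem abs_sum_defect_mul_le (hlam : Expanding k lam) (hκ : 0 ≤ κ) (hQ : 4 ≤ Q)
    (hκQ : 16 * κ * Q ^ 2 ≤ 1)
    (hret : HasReturns (fun w : Node d k => (prodMult lam w.1)⁻¹) κ H)
    {P φ : ℝ → ℝ} (hP01 : P 0 = P 1)
    (hP : ∀ x x' : ℝ, 0 ≤ x → x ≤ 1 → 0 ≤ x' → x' ≤ 1 →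
      |P x' - P x - φ x * (x' - x)| ≤ (x' - x) ^ 2)
    (hφ : ∀ x : ℝ, 0 ≤ x → x ≤ 1 → |φ x| ≤ 1 / 2)
    {w : List (Fin d)} (hw : w ≠ []) (hk : w.length ≤ k) {ψ : ℤ → ℝ} (hψ : ∀ Y, |ψ Y| ≤ 1)
    {u : List (Fin d)} (huk : u.length ≤ k)
    (hψs : ∀ (σ : ℝ) (h : ℕ) (a : List (Fin d) → ℤ), IsShift k lam κ w σ h a →
      ∀ Y, Regular lam v κ u Y → |ψ (Y + h) - ψ Y| ≤ 2 * κ)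
    (y : ℤ) (n : ℕ) :
    |∑ t ∈ Finset.range n, φ (defect lam v w (y + t)) * ψ (y + t)| ≤
      5 * 3 ^ k * (n * (14 / Q) + 2 * H) := by
  have hQ0 : 0 < Q := by omega
  have hQ' : (4 : ℝ) ≤ Q := by exact_mod_cast hQ
  have hl := length_eq_dropLast_succ hw
  choose h hH a hs using fun j : ℕ => exists_isShift hret w ((j % Q : ℕ) / Q : ℝ)
  have hφ' : ∀ Y, |φ (defect lam v w Y)| ≤ 1 / 2 := fun Y =>
    hφ _ (defect_mem hw Y).1.le (defect_mem hw Y).2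
  have hκQ1 : κ * Q ≤ 1 / 64 := by
    have : κ * Q * 4 ≤ κ * Q * Q := by gcongr
    nlinarith
  have hf1 : ∀ Y, |φ (defect lam v w Y) * ψ Y| ≤ 1 := fun Y => by
    rw [abs_mul]
    exact mul_le_one₀ ((hφ' Y).trans (by norm_num)) (abs_nonneg _) (hψ Y)
  have hgood : ∀ Y, Regular lam v κ w.dropLast Y ∧ Regular lam v κ u Y →
      |∑ j ∈ Finset.range Q, φ (defect lam v w (Y + h j)) * ψ (Y + h j) - Q * 0| ≤
        Q * (14 / Q) := by
    rintro Y ⟨hY, hYu⟩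
    rw [mul_zero, sub_zero, mul_div_cancel₀ _ (by positivity)]
    choose b hb using fun j => (hs j).exists_defect_add_sub_le hlam hκ hw hk hY
    have hcyc := abs_sum_le_of_cyclic hP01 hP hφ hQ hκQ (x := fun j => defect lam v w (Y + h (j % Q)))
      (b := fun j => if j < Q then b j else b 0 - 1) (x₀ := defect lam v w Y)
      (fun j _ => defect_mem hw _) (by simp) (by
        intro j hj
        rcases hj.lt_or_eq with hj | rfl
        · have := hb j
          rw [Nat.mod_eq_of_lt hj] at this
          simpa [hj, Nat.mod_eq_of_lt hj] using this
        · have := hb 0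
          simp only [Nat.zero_mod, Nat.cast_zero, zero_div, sub_zero] at this
          simp only [lt_irrefl, if_false, Nat.mod_self]
          rw [div_self (by positivity)]
          push_cast
          rw [show ∀ x y z : ℝ, x - y - 1 - (z - 1) = x - y - z by intros; ring]
          exact this)
    have e1 : ∑ j ∈ Finset.range Q, φ (defect lam v w (Y + h (j % Q))) =
        ∑ j ∈ Finset.range Q, φ (defect lam v w (Y + h j)) :=
      Finset.sum_congr rfl fun j hj => by rw [Nat.mod_eq_of_lt (Finset.mem_range.1 hj)]
    simp only [e1] at hcyc
    have e2 : ∑ j ∈ Finset.range Q, φ (defect lam v w (Y + h j)) * ψ (Y + h j) =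
        (∑ j ∈ Finset.range Q, φ (defect lam v w (Y + h j))) * ψ Y +
        ∑ j ∈ Finset.range Q, φ (defect lam v w (Y + h j)) * (ψ (Y + h j) - ψ Y) := by
      rw [Finset.sum_mul, ← Finset.sum_add_distrib]
      exact Finset.sum_congr rfl fun j _ => by ring
    have h3 : |(∑ j ∈ Finset.range Q, φ (defect lam v w (Y + h j))) * ψ Y| ≤ 12 * 1 := by
      rw [abs_mul]
      exact mul_le_mul hcyc (hψ Y) (abs_nonneg _) (by norm_num)
    have h4 : |∑ j ∈ Finset.range Q, φ (defect lam v w (Y + h j)) * (ψ (Y + h j) - ψ Y)| ≤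
        Q * (1 / 2 * (2 * κ)) := by
      refine (Finset.abs_sum_le_sum_abs _ _).trans ?_
      have := Finset.sum_le_card_nsmul (Finset.range Q)
        (fun j => |φ (defect lam v w (Y + h j)) * (ψ (Y + h j) - ψ Y)|) (1 / 2 * (2 * κ)) (by
          intro j _
          rw [abs_mul]
          exact mul_le_mul (hφ' _) (hψs _ _ _ (hs j) Y hYu) (abs_nonneg _) (by norm_num))
      simpa using this
    rw [e2]
    refine (abs_add_le _ _).trans ?_
    linarith
  have key := abs_sum_sub_le_of_shifts (B := 1) (c := 0) (ε := 14 / Q) hf1 (by simp) hQ0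
    (fun j _ => hH j) (by positivity)
    (fun Y => Regular lam v κ w.dropLast Y ∧ Regular lam v κ u Y) hgood y n
  have hcount : (∑ t ∈ Finset.range n, (if Regular lam v κ w.dropLast (y + t) ∧
      Regular lam v κ u (y + t) then (0 : ℝ) else 1)) ≤
      irregularCount lam v κ w.dropLast y n + irregularCount lam v κ u y n := by
    unfold irregularCount
    rw [← Finset.sum_add_distrib]
    refine Finset.sum_le_sum fun t _ => ?_
    by_cases h1 : Regular lam v κ w.dropLast (y + t) <;>
      by_cases h2 : Regular lam v κ u (y + t) <;> simp [h1, h2]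
  have hX : (n : ℝ) * (1 / Q) + 2 * H ≤ n * (14 / Q) + 2 * H := by gcongr; norm_num
  have hX0 : 0 ≤ (n : ℝ) * (1 / Q) + 2 * H := by positivity
  have hirr : ∀ u : List (Fin d), u.length ≤ k → irregularCount lam v κ u y n ≤
      3 ^ k * (n * (14 / Q) + 2 * H) - (n * (1 / Q) + 2 * H) := by
    intro u hu
    have h1 := irregularCount_le (v := v) hlam hκ hQ0 (by linarith) hret y n u hu
    have h2 : (3 : ℝ) ^ u.length * (n * (1 / Q) + 2 * H) ≤ 3 ^ k * (n * (14 / Q) + 2 * H) := by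
      gcongr; norm_num
    linarith
  have h5 := hirr u huk
  have h6 := hirr w.dropLast (by omega)
  have h7 : (1 : ℝ) ≤ 3 ^ k := one_le_pow₀ (by norm_num)
  have h8 : 1 * ((n : ℝ) * (14 / Q) + 2 * H) ≤ 3 ^ k * (n * (14 / Q) + 2 * H) := by gcongr
  rw [mul_zero, sub_zero] at key
  linarith

end Averages

section Moments

variable {d k : ℕ} {lam v : List (Fin d) → ℝ} {κ : ℝ} {Q H : ℕ}

theorem abs_defect_sub_half_le {w : List (Fin d)} (hw : w ≠ []) (Y : ℤ) :
    |defect lam v w Y - 1 / 2| ≤ 1 / 2 := by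
  obtain ⟨h1, h2⟩ := defect_mem (lam := lam) (v := v) hw Y
  rw [abs_le]; constructor <;> linarith

theorem abs_sum_defect_sub_half_mul_le (hlam : Expanding k lam) (hκ : 0 ≤ κ) (hQ : 4 ≤ Q)
    (hκQ : 16 * κ * Q ^ 2 ≤ 1)
    (hret : HasReturns (fun w : Node d k => (prodMult lam w.1)⁻¹) κ H)
    {w : List (Fin d)} (hw : w ≠ []) (hk : w.length ≤ k) {ψ : ℤ → ℝ} (hψ : ∀ Y, |ψ Y| ≤ 1)
    {u : List (Fin d)} (huk : u.length ≤ k)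
    (hψs : ∀ (σ : ℝ) (h : ℕ) (a : List (Fin d) → ℤ), IsShift k lam κ w σ h a →
      ∀ Y, Regular lam v κ u Y → |ψ (Y + h) - ψ Y| ≤ 2 * κ)
    (y : ℤ) (n : ℕ) :
    |∑ t ∈ Finset.range n, (defect lam v w (y + t) - 1 / 2) * ψ (y + t)| ≤
      5 * 3 ^ k * (n * (14 / Q) + 2 * H) := by
  refine abs_sum_defect_mul_le (P := fun x => (x ^ 2 - x) / 2) (φ := fun x => x - 1 / 2) hlam hκ hQ
    hκQ hret (by norm_num) ?_ ?_ hw hk hψ huk hψs y n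
  · intro x x' _ _ _ _
    have e : (x' ^ 2 - x') / 2 - (x ^ 2 - x) / 2 - (x - 1 / 2) * (x' - x) = (x' - x) ^ 2 / 2 := by
      ring
    rw [e, abs_of_nonneg (by positivity)]
    linarith [sq_nonneg (x' - x)]
  · intro x h0 h1
    rw [abs_le]; constructor <;> linarith

theorem abs_sum_defect_sub_half_le (hlam : Expanding k lam) (hκ : 0 ≤ κ) (hQ : 4 ≤ Q)
    (hκQ : 16 * κ * Q ^ 2 ≤ 1)
    (hret : HasReturns (fun w : Node d k => (prodMult lam w.1)⁻¹) κ H)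
    {w : List (Fin d)} (hw : w ≠ []) (hk : w.length ≤ k) (y : ℤ) (n : ℕ) :
    |∑ t ∈ Finset.range n, (defect lam v w (y + t) - 1 / 2)| ≤
      5 * 3 ^ k * (n * (14 / Q) + 2 * H) := by
  simpa using abs_sum_defect_sub_half_mul_le (v := v) hlam hκ hQ hκQ hret hw hk (ψ := fun _ => 1)
    (by simp) (u := []) (by simp) (by intro _ _ _ _ _ _; simpa using hκ) y n

/-- The centred defects of different words are asymptotically uncorrelated, and each has the variance
of the uniform law on an interval of length `1`. -/
theorem abs_sum_defect_correlation_le (hlam : Expanding k lam) (hκ : 0 ≤ κ) (hQ : 4 ≤ Q)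
    (hκQ : 16 * κ * Q ^ 2 ≤ 1)
    (hret : HasReturns (fun w : Node d k => (prodMult lam w.1)⁻¹) κ H)
    {w u : List (Fin d)} (hw : w ≠ []) (hk : w.length ≤ k) (hu : u ≠ []) (huk : u.length ≤ k)
    (y : ℤ) (n : ℕ) :
    |∑ t ∈ Finset.range n, (defect lam v w (y + t) - 1 / 2) * (defect lam v u (y + t) - 1 / 2) -
      n * (if w = u then 1 / 12 else 0)| ≤ 5 * 3 ^ k * (n * (14 / Q) + 2 * H) := by
  by_cases hwu : w = u
  · subst hwu
    have h1 := abs_sum_defect_mul_le (v := v) (P := fun x => ((x - 1 / 2) ^ 3 - (x - 1 / 2) / 4) / 3)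
      (φ := fun x => (x - 1 / 2) * (x - 1 / 2) - 1 / 12) hlam hκ hQ
      hκQ hret (by norm_num) (by
        intro x x' h0 h1 h0' h1'
        have e : ((x' - 1 / 2) ^ 3 - (x' - 1 / 2) / 4) / 3 - ((x - 1 / 2) ^ 3 - (x - 1 / 2) / 4) / 3 -
            ((x - 1 / 2) * (x - 1 / 2) - 1 / 12) * (x' - x) =
            (x' - x) ^ 2 * ((x - 1 / 2) + (x' - x) / 3) := by ring
        rw [e, abs_mul, abs_of_nonneg (sq_nonneg _)]
        apply mul_le_of_le_one_right (sq_nonneg _)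
        rw [abs_le]; constructor <;> linarith) (by
        intro x h0 h1
        rw [abs_le]; constructor <;> nlinarith) hw hk (ψ := fun _ => 1)
      (by simp) (u := []) (by simp) (by intro _ _ _ _ _ _; simpa using hκ) y n
    simpa using h1
  · rw [if_neg hwu, mul_zero, sub_zero]
    wlog hl : u.length ≤ w.length generalizing w u
    · simp only [mul_comm (defect lam v w _ - 1 / 2)]
      exact this hu huk hw hk (Ne.symm hwu) (by omega)
    refine abs_sum_defect_sub_half_mul_le (ψ := fun Y => defect lam v u Y - 1 / 2) hlam hκ hQ hκQ
      hret hw hk (fun Y => (abs_defect_sub_half_le hu Y).trans (by norm_num)) huk ?_ y n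
    intro σ h a hs Y hY
    rw [sub_sub_sub_cancel_right]
    exact hs.defect_add_sub_le hlam hκ hu huk (ancestor_ne_of_length hl (Ne.symm hwu)) hY

theorem fluctuation_eq_sum (Y : ℤ) : fluctuation k lam v Y =
    ∑ p ∈ (Finset.univ : Finset (Leaf d k)) ×ˢ Finset.range k,
      weight lam p.1.toList p.2 * (defect lam v (ancestor p.2 p.1.toList) Y - 1 / 2) := by
  rw [Finset.sum_product]; rfl

theorem card_leaf_product :
    (((Finset.univ : Finset (Leaf d k)) ×ˢ Finset.range k).card : ℝ) = k * d ^ k := by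
  rw [Finset.card_product]; simp [mul_comm]

theorem abs_sum_fluctuation_le (hlam : Expanding k lam) (hκ : 0 ≤ κ) (hQ : 4 ≤ Q)
    (hκQ : 16 * κ * Q ^ 2 ≤ 1)
    (hret : HasReturns (fun w : Node d k => (prodMult lam w.1)⁻¹) κ H) (y : ℤ) (n : ℕ) :
    |∑ t ∈ Finset.range n, fluctuation k lam v (y + t)| ≤
      k * d ^ k * (5 * 3 ^ k * (n * (14 / Q) + 2 * H)) := by
  simp only [fluctuation_eq_sum]
  rw [Finset.sum_comm]
  simp only [← Finset.mul_sum]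
  refine (Finset.abs_sum_le_sum_abs _ _).trans ?_
  rw [← card_leaf_product (d := d), ← nsmul_eq_mul]
  refine Finset.sum_le_card_nsmul _ _ _ fun p hp => ?_
  have hp2 : p.2 < k := by simpa using hp
  have hi : p.1.toList.length = k := p.1.toList_length
  rw [abs_mul, abs_of_nonneg (weight_nonneg hlam hi.le _)]
  refine (mul_le_of_le_one_left (abs_nonneg _) (weight_le_one hlam hi.le _)).trans ?_
  exact abs_sum_defect_sub_half_le hlam hκ hQ hκQ hret (ancestor_ne_nil (by omega))
    (by rw [length_ancestor]; omega) y n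

theorem ancestor_eq_iff {i i' : Leaf d k} {m m' : ℕ} (hm : m < k) (hm' : m' < k) :
    ancestor m i.toList = ancestor m' i'.toList ↔ m = m' ∧ meetTime i i' ≤ m := by
  have hi : i.toList.length = k := i.toList_length
  have hi' : i'.toList.length = k := i'.toList_length
  have hmem : ∀ m, k ≤ m → ancestor m i.toList = ancestor m i'.toList := by
    intro m hm
    rw [List.length_eq_zero_iff.1 (by rw [length_ancestor]; omega : (ancestor m i.toList).length = 0),
      List.length_eq_zero_iff.1 (by rw [length_ancestor]; omega : (ancestor m i'.toList).length = 0)]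
  have hmeet : meetTime i i' ∈
      {m : ℕ | m ≤ k ∧ ancestor m i.toList = ancestor m i'.toList} :=
    Nat.sInf_mem ⟨k, le_rfl, hmem k le_rfl⟩
  constructor
  · intro h
    have hl := congrArg List.length h
    rw [length_ancestor, length_ancestor] at hl
    obtain rfl : m = m' := by omega
    exact ⟨rfl, Nat.sInf_le ⟨hm.le, h⟩⟩
  · rintro ⟨rfl, h⟩
    induction h using Nat.leRec with
    | refl => exact hmeet.2
    | le_succ_of_le h ih => rw [ancestor_succ, ancestor_succ, ih (by omega) (by omega)]

theorem cramerFormula_eq : cramerFormula k lam = (totalMult k lam)⁻¹ ^ 2 / 12 +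
    ∑ p ∈ (Finset.univ : Finset (Leaf d k)) ×ˢ Finset.range k,
      ∑ q ∈ (Finset.univ : Finset (Leaf d k)) ×ˢ Finset.range k,
        weight lam p.1.toList p.2 * weight lam q.1.toList q.2 *
          (if ancestor p.2 p.1.toList = ancestor q.2 q.1.toList then 1 / 12 else 0) := by
  have e1 : 1 / (12 * totalMult k lam ^ 2) = (totalMult k lam)⁻¹ ^ 2 / 12 := by
    rw [inv_pow, one_div, mul_inv]; ring
  rw [cramerFormula, e1, Finset.sum_product]
  simp only [Finset.sum_product]
  congr 1
  rw [Finset.mul_sum]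
  refine Finset.sum_congr rfl fun i _ => ?_
  rw [Finset.sum_comm, Finset.mul_sum]
  refine Finset.sum_congr rfl fun i' _ => ?_
  have e2 : ∀ m ∈ Finset.range k, ∑ m' ∈ Finset.range k,
      weight lam i.toList m * weight lam i'.toList m' *
        (if ancestor m i.toList = ancestor m' i'.toList then (1 : ℝ) / 12 else 0) =
      if meetTime i i' ≤ m then 1 / 12 * (weight lam i.toList m * weight lam i'.toList m) else 0 := by
    intro m hm
    have hm' := Finset.mem_range.1 hm
    rw [Finset.sum_eq_single_of_mem m hm]
    · simp only [ancestor_eq_iff hm' hm', true_and]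
      split_ifs <;> ring
    · intro m' hmm' hne
      rw [if_neg, mul_zero]
      rw [ancestor_eq_iff hm' (Finset.mem_range.1 hmm')]
      exact fun h => hne h.1.symm
  rw [Finset.sum_congr rfl e2, ← Finset.sum_filter, Finset.mul_sum]
  have e3 : (Finset.range k).filter (fun m => meetTime i i' ≤ m) = Finset.Ico (meetTime i i') k := by
    ext m; simp [and_comm]
  rw [e3]
  refine Finset.sum_congr rfl fun m _ => ?_
  rw [weight, weight]
  ring

theorem abs_sum_fluctuation_sq_le (hlam : Expanding k lam) (hκ : 0 ≤ κ) (hQ : 4 ≤ Q)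
    (hκQ : 16 * κ * Q ^ 2 ≤ 1)
    (hret : HasReturns (fun w : Node d k => (prodMult lam w.1)⁻¹) κ H) (y : ℤ) (n : ℕ) :
    |∑ t ∈ Finset.range n, fluctuation k lam v (y + t) ^ 2 -
        n * (cramerFormula k lam - (totalMult k lam)⁻¹ ^ 2 / 12)| ≤
      ((k : ℝ) * d ^ k) ^ 2 * (5 * 3 ^ k * (n * (14 / Q) + 2 * H)) := by
  rw [cramerFormula_eq, add_sub_cancel_left]
  simp only [fluctuation_eq_sum, sq, Finset.sum_mul_sum]
  rw [Finset.sum_comm, Finset.mul_sum, ← Finset.sum_sub_distrib, mul_assoc,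
    ← card_leaf_product (d := d), ← nsmul_eq_mul]
  refine (Finset.abs_sum_le_sum_abs _ _).trans (Finset.sum_le_card_nsmul _ _ _ fun p hp => ?_)
  rw [Finset.sum_comm, Finset.mul_sum, ← Finset.sum_sub_distrib, ← nsmul_eq_mul]
  refine (Finset.abs_sum_le_sum_abs _ _).trans (Finset.sum_le_card_nsmul _ _ _ fun q hq => ?_)
  have hp2 : p.2 < k := by simpa using hp
  have hpi : p.1.toList.length = k := p.1.toList_length
  have hq2 : q.2 < k := by simpa using hq
  have hqi : q.1.toList.length = k := q.1.toList_length
  have key := abs_sum_defect_correlation_le (v := v) hlam hκ hQ hκQ hret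
    (w := ancestor p.2 p.1.toList) (u := ancestor q.2 q.1.toList) (ancestor_ne_nil (by omega))
    (by rw [length_ancestor]; omega) (ancestor_ne_nil (by omega)) (by rw [length_ancestor]; omega) y n
  have hw1 := weight_le_one hlam hpi.le p.2
  have hw2 := weight_le_one hlam hqi.le q.2
  have hw3 := weight_nonneg hlam hpi.le p.2
  have hw4 := weight_nonneg hlam hqi.le q.2
  generalize (if ancestor p.2 p.1.toList = ancestor q.2 q.1.toList then (1 : ℝ) / 12 else 0) = c at *
  have e : ∀ t : ℕ, weight lam p.1.toList p.2 * (defect lam v (ancestor p.2 p.1.toList) (y + t) - 1 / 2) *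
      (weight lam q.1.toList q.2 * (defect lam v (ancestor q.2 q.1.toList) (y + t) - 1 / 2)) =
      weight lam p.1.toList p.2 * weight lam q.1.toList q.2 *
      ((defect lam v (ancestor p.2 p.1.toList) (y + t) - 1 / 2) *
        (defect lam v (ancestor q.2 q.1.toList) (y + t) - 1 / 2)) := fun t => by ring
  simp only [e, ← Finset.mul_sum]
  rw [mul_left_comm, ← mul_sub, abs_mul, abs_of_nonneg (mul_nonneg hw3 hw4)]
  exact (mul_le_of_le_one_left (abs_nonneg _) (mul_le_one₀ hw1 hw4 hw2)).trans key

end Moments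

/-! ### Averages of the cumulated difference -/

theorem abs_integral_sub_sum_le {f : ℝ → ℝ} {g : ℕ → ℝ → ℝ} (hg : ∀ j, Continuous (g j))
    (hfg : ∀ j : ℕ, ∀ t : ℝ, (j : ℝ) ≤ t → t < j + 1 → f t = g j t) {B : ℝ}
    (hB : ∀ t : ℝ, 0 ≤ t → |f t| ≤ B) {R : ℝ} (hR : 0 ≤ R) :
    |(∫ t in (0 : ℝ)..R, f t) - ∑ j ∈ Finset.range ⌊R⌋₊, ∫ t in (j : ℝ)..(j + 1), g j t| ≤ B := by
  have hae : ∀ j : ℕ, ∀ᵐ t : ℝ, t ∈ uIoc (j : ℝ) (j + 1) → f t = g j t := by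
    intro j
    have h1 : ∀ᵐ t : ℝ, t ≠ j + 1 := by simp [ae_iff, measure_singleton]
    filter_upwards [h1] with t ht htm
    rw [uIoc_of_le (by linarith)] at htm
    exact hfg j t htm.1.le (lt_of_le_of_ne htm.2 ht)
  have hint : ∀ j : ℕ, IntervalIntegrable f volume (j : ℝ) (j + 1) := by
    intro j
    refine ((hg j).intervalIntegrable _ _).congr_ae ?_
    rw [Filter.EventuallyEq, ae_restrict_iff' measurableSet_uIoc]
    filter_upwards [hae j] with t ht htm using (ht htm).symm
  have hsum : ∑ j ∈ Finset.range ⌊R⌋₊, ∫ t in (j : ℝ)..(j + 1), g j t =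
      ∫ t in (0 : ℝ)..⌊R⌋₊, f t := by
    have := intervalIntegral.sum_integral_adjacent_intervals (f := f) (μ := volume)
      (a := fun j : ℕ => (j : ℝ)) (n := ⌊R⌋₊) (fun j _ => by push_cast; exact hint j)
    rw [Nat.cast_zero] at this
    rw [← this]
    refine Finset.sum_congr rfl fun j _ => ?_
    push_cast
    exact (intervalIntegral.integral_congr_ae (hae j)).symm
  have hint0 : IntervalIntegrable f volume 0 ⌊R⌋₊ := by
    have := IntervalIntegrable.trans_iterate (f := f) (μ := volume)
      (a := fun j : ℕ => (j : ℝ)) (n := ⌊R⌋₊) (fun j _ => by push_cast; exact hint j)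
    simpa using this
  have hfl := Nat.floor_le hR
  have hlt := Nat.lt_floor_add_one R
  have hint1 : IntervalIntegrable f volume ⌊R⌋₊ R := by
    refine (hint ⌊R⌋₊).mono_set ?_
    rw [uIcc_of_le hfl, uIcc_of_le (by linarith)]
    exact Icc_subset_Icc_right hlt.le
  rw [hsum, ← intervalIntegral.integral_add_adjacent_intervals hint0 hint1, add_sub_cancel_left]
  have hB0 : 0 ≤ B := (abs_nonneg _).trans (hB 0 le_rfl)
  have := intervalIntegral.norm_integral_le_of_norm_le_const (a := (⌊R⌋₊ : ℝ)) (b := R) (C := B)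
    (f := f) (fun t ht => by
      rw [uIoc_of_le hfl] at ht
      exact hB t ((Nat.cast_nonneg _).trans ht.1.le))
  rw [Real.norm_eq_abs, abs_of_nonneg (by linarith : 0 ≤ R - ⌊R⌋₊)] at this
  nlinarith

theorem integral_affine_unit (a p c : ℝ) :
    ∫ t in a..(a + 1), (p * (t - a - 1 / 2) + c) = c := by
  have h : ∀ t ∈ uIcc a (a + 1), HasDerivAt (fun t => p * (t - a - 1 / 2) ^ 2 / 2 + c * t)
      (p * (t - a - 1 / 2) + c) t := by
    intro t _
    have h1 : HasDerivAt (fun t : ℝ => t - a - 1 / 2) 1 t :=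
      ((hasDerivAt_id t).sub_const a).sub_const (1 / 2)
    have h2 := ((((h1.pow 2).const_mul p).div_const 2).add ((hasDerivAt_id t).const_mul c))
    refine h2.congr_deriv ?_
    norm_num; ring
  rw [intervalIntegral.integral_eq_sub_of_hasDerivAt h
    (Continuous.intervalIntegrable (by fun_prop) _ _)]
  ring

theorem integral_affine_sq_unit (a p c : ℝ) :
    ∫ t in a..(a + 1), (p * (t - a - 1 / 2) + c) ^ 2 = p ^ 2 / 12 + c ^ 2 := by
  have h : ∀ t ∈ uIcc a (a + 1), HasDerivAt
      (fun t => p ^ 2 * (t - a - 1 / 2) ^ 3 / 3 + p * c * (t - a - 1 / 2) ^ 2 + c ^ 2 * t)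
      ((p * (t - a - 1 / 2) + c) ^ 2) t := by
    intro t _
    have h1 : HasDerivAt (fun t : ℝ => t - a - 1 / 2) 1 t :=
      ((hasDerivAt_id t).sub_const a).sub_const (1 / 2)
    have h2 := ((((h1.pow 3).const_mul (p ^ 2)).div_const 3).add
      ((h1.pow 2).const_mul (p * c))).add ((hasDerivAt_id t).const_mul (c ^ 2))
    refine h2.congr_deriv ?_
    norm_num; ring
  rw [intervalIntegral.integral_eq_sub_of_hasDerivAt h
    (Continuous.intervalIntegrable (by fun_prop) _ _)]
  ring

section Mean

variable {d k : ℕ} {lam v : List (Fin d) → ℝ} {κ : ℝ} {Q H : ℕ}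

theorem cramerFormula_mem (hlam : Expanding k lam) :
    0 ≤ cramerFormula k lam ∧ cramerFormula k lam ≤ ((d : ℝ) ^ k + k * d ^ k + 1) ^ 2 := by
  have h1 := totalMult_inv_nonneg hlam
  have h2 := totalMult_inv_le hlam
  set P := (Finset.univ : Finset (Leaf d k)) ×ˢ Finset.range k
  have h3 : ∀ p ∈ P, ∀ q ∈ P, 0 ≤ weight lam p.1.toList p.2 * weight lam q.1.toList q.2 *
      (if ancestor p.2 p.1.toList = ancestor q.2 q.1.toList then (1 : ℝ) / 12 else 0) ∧
      weight lam p.1.toList p.2 * weight lam q.1.toList q.2 *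
      (if ancestor p.2 p.1.toList = ancestor q.2 q.1.toList then (1 : ℝ) / 12 else 0) ≤ 1 := by
    intro p _ q _
    have hw1 := weight_le_one hlam p.1.toList_length.le p.2
    have hw2 := weight_le_one hlam q.1.toList_length.le q.2
    have hw3 := weight_nonneg hlam p.1.toList_length.le p.2
    have hw4 := weight_nonneg hlam q.1.toList_length.le q.2
    have hw5 := mul_le_one₀ hw1 hw4 hw2
    have hw6 := mul_nonneg hw3 hw4
    split_ifs <;> constructor <;> linarith
  have h4 : ∀ p ∈ P, ∑ q ∈ P, weight lam p.1.toList p.2 * weight lam q.1.toList q.2 *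
      (if ancestor p.2 p.1.toList = ancestor q.2 q.1.toList then (1 : ℝ) / 12 else 0) ≤
      k * d ^ k := by
    intro p hp
    rw [← card_leaf_product (d := d), ← mul_one (P.card : ℝ), ← nsmul_eq_mul]
    exact Finset.sum_le_card_nsmul _ _ _ fun q hq => (h3 p hp q hq).2
  have h5 := Finset.sum_le_card_nsmul _ _ _ h4
  rw [nsmul_eq_mul, card_leaf_product] at h5
  have h6 := Finset.sum_nonneg fun p hp => Finset.sum_nonneg fun q hq => (h3 p hp q hq).1
  have h7 : (totalMult k lam)⁻¹ ^ 2 ≤ ((d : ℝ) ^ k) ^ 2 := by gcongr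
  have h8 : (0 : ℝ) ≤ d ^ k := by positivity
  have h9 : (0 : ℝ) ≤ k * d ^ k := by positivity
  rw [cramerFormula_eq]
  constructor
  · positivity
  · nlinarith

/-- The mean and the mean square of the cumulated difference over a long window. -/
theorem mean_cumDiff_bounds (hlam : Expanding k lam) (hκ : 0 ≤ κ) (hQ : 4 ≤ Q)
    (hκQ : 16 * κ * Q ^ 2 ≤ 1)
    (hret : HasReturns (fun w : Node d k => (prodMult lam w.1)⁻¹) κ H)
    {ε : ℝ} (hε : k * d ^ k * ε ≤ 1) {y : ℤ} (hy : HasSmallErrors k lam v ε y)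
    {K A B R : ℝ} (hK : K = k * d ^ k) (hA : A = (K + 1) ^ 2 * (5 * 3 ^ k))
    (hB : B = d ^ k + k * d ^ k + 1) (hR : 0 < R) :
    |1 / R * ∫ x in (0 : ℝ)..R,
      cumDiff (translateNeg (imageMeasure k lam v) y) (scaledLeb (totalMult k lam)⁻¹) x| ≤
      K * ε + A * (14 / Q) + 2 * (A * H + B ^ 2) / R ∧
    |cramerDist R (translateNeg (imageMeasure k lam v) y) (scaledLeb (totalMult k lam)⁻¹) ^ 2
      - cramerFormula k lam| ≤ K * ε + A * (14 / Q) + 2 * (A * H + B ^ 2) / R := by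
  obtain ⟨F, hF⟩ : ∃ F, F = cumDiff (translateNeg (imageMeasure k lam v) y)
    (scaledLeb (totalMult k lam)⁻¹) := ⟨_, rfl⟩
  obtain ⟨n, hn⟩ : ∃ n, n = ⌊R⌋₊ := ⟨_, rfl⟩
  have hF' : ∀ t, 0 ≤ t → F t = -((totalMult k lam)⁻¹ * (Int.fract t - 1 / 2)) -
      fluctuation k lam v (y + ⌊t⌋) + bias k lam v y := fun t ht => by
    rw [hF]; exact cumDiff_eq hlam hy ht
  have hbias := abs_bias_le hlam hy
  have hflu := abs_sum_fluctuation_le (v := v) hlam hκ hQ hκQ hret y n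
  have hflu2 := abs_sum_fluctuation_sq_le (v := v) hlam hκ hQ hκQ hret y n
  have hΛ0 := totalMult_inv_nonneg hlam
  have hΛ1 := totalMult_inv_le hlam
  obtain ⟨hform0, hform1⟩ := cramerFormula_mem hlam
  rw [← hB] at hform1
  rw [← hK] at hbias hflu hflu2 hε
  have hK0 : 0 ≤ K := by rw [hK]; positivity
  have hnR : (n : ℝ) ≤ R := by rw [hn]; exact Nat.floor_le hR.le
  have hnR' : R ≤ n + 1 := by rw [hn]; exact (Nat.lt_floor_add_one R).le
  have hFB : ∀ t, 0 ≤ t → |F t| ≤ B := by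
    intro t ht
    have h1 := abs_le.1 (abs_fluctuation_le (v := v) hlam (y + ⌊t⌋))
    have h2 := abs_le.1 hbias
    have h3 := Int.fract_nonneg t
    have h4 := Int.fract_lt_one t
    rw [hF' t ht, hB, abs_le]
    constructor <;> nlinarith only [h1.1, h1.2, h2.1, h2.2, h3, h4, hε, hΛ0, hΛ1]
  have hB1 : 1 ≤ B := by
    rw [hB]
    have : (0 : ℝ) ≤ d ^ k + k * d ^ k := by positivity
    linarith
  generalize hΛ : (totalMult k lam)⁻¹ = Λ at *
  generalize hβ : bias k lam v y = β at *
  generalize hform : cramerFormula k lam = V at *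
  obtain ⟨g, hg⟩ : ∃ g : ℕ → ℝ → ℝ, g = fun (j : ℕ) t =>
    -Λ * (t - j - 1 / 2) + (β - fluctuation k lam v (y + j)) := ⟨_, rfl⟩
  have hFg : ∀ j : ℕ, ∀ t : ℝ, (j : ℝ) ≤ t → t < j + 1 → F t = g j t := by
    intro j t h1 h2
    have hfl : ⌊t⌋ = (j : ℤ) := by rw [Int.floor_eq_iff]; push_cast; exact ⟨h1, h2⟩
    rw [hF' t ((Nat.cast_nonneg j).trans h1), ← Int.self_sub_floor, hfl, hg]
    push_cast; ring
  have hgc : ∀ j, Continuous (g j) := fun j => by rw [hg]; fun_prop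
  have hI1 := abs_integral_sub_sum_le hgc hFg hFB hR.le
  have hI2 := abs_integral_sub_sum_le (f := fun t => F t ^ 2) (g := fun j t => g j t ^ 2) (B := B ^ 2)
    (fun j => (hgc j).pow 2) (fun j t h1 h2 => by rw [hFg j t h1 h2])
    (fun t ht => by
      rw [abs_of_nonneg (sq_nonneg _), ← sq_abs]
      exact pow_le_pow_left₀ (abs_nonneg _) (hFB t ht) 2) hR.le
  simp only [hg, integral_affine_unit, integral_affine_sq_unit] at hI1 hI2
  rw [← hn] at hI1 hI2
  obtain ⟨D, hD⟩ : ∃ D : ℝ, D = 5 * 3 ^ k * (n * (14 / Q) + 2 * H) := ⟨_, rfl⟩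
  have hD0 : 0 ≤ D := by rw [hD]; positivity
  rw [← hD] at hflu hflu2
  obtain ⟨S1, hS1⟩ : ∃ S, S = ∑ t ∈ Finset.range n, fluctuation k lam v (y + t) := ⟨_, rfl⟩
  obtain ⟨S2, hS2⟩ : ∃ S, S = ∑ t ∈ Finset.range n, fluctuation k lam v (y + t) ^ 2 := ⟨_, rfl⟩
  have e1 : ∑ j ∈ Finset.range n, (β - fluctuation k lam v (y + j)) = n * β - S1 := by
    rw [Finset.sum_sub_distrib, hS1]; simp
  have e2 : ∑ j ∈ Finset.range n, ((-Λ) ^ 2 / 12 + (β - fluctuation k lam v (y + j)) ^ 2) =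
      n * (Λ ^ 2 / 12) + n * β ^ 2 - 2 * β * S1 + S2 := by
    have : ∀ j : ℕ, (-Λ) ^ 2 / 12 + (β - fluctuation k lam v (y + j)) ^ 2 =
      Λ ^ 2 / 12 + β ^ 2 - 2 * β * fluctuation k lam v (y + j) + fluctuation k lam v (y + j) ^ 2 :=
      fun j => by ring
    simp only [this, Finset.sum_add_distrib, Finset.sum_sub_distrib, ← Finset.mul_sum, ← hS1, ← hS2]
    simp
  rw [e1] at hI1
  rw [e2] at hI2
  rw [← hS1] at hflu
  rw [← hS2] at hflu2
  have hβ1 : |β| ≤ 1 := hbias.trans hε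
  have hβ2 : β ^ 2 ≤ K * ε := by
    rw [← sq_abs]; nlinarith only [abs_nonneg β, hβ1, hbias]
  have hAD : (K + 1) ^ 2 * D ≤ R * (A * (14 / Q)) + 2 * (A * H) := by
    have h1 : A * (n * (14 / Q)) ≤ A * (R * (14 / Q)) := by
      have : 0 ≤ A := by rw [hA]; positivity
      gcongr
    have h2 : (K + 1) ^ 2 * D = A * (n * (14 / Q)) + 2 * (A * H) := by rw [hA, hD]; ring
    linarith
  have hKε : 0 ≤ K * ε := (abs_nonneg _).trans hbias
  have hn0 : (0 : ℝ) ≤ n := Nat.cast_nonneg n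
  have hBB : B ≤ B ^ 2 := by nlinarith only [hB1]
  have hfin : ∀ x : ℝ, |x| ≤ R * (K * ε) + R * (A * (14 / Q)) + 2 * (A * H) + 2 * B ^ 2 →
      |1 / R * x| ≤ K * ε + A * (14 / Q) + 2 * (A * H + B ^ 2) / R := by
    intro x hx
    rw [abs_mul, abs_of_pos (by positivity : 0 < 1 / R), one_div, inv_mul_le_iff₀ hR]
    have : R * (K * ε + A * (14 / Q) + 2 * (A * H + B ^ 2) / R) =
      R * (K * ε) + R * (A * (14 / Q)) + 2 * (A * H) + 2 * B ^ 2 := by field_simp; ring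
    rwa [this]
  constructor
  · rw [← hF]
    apply hfin
    have h1 : |(n : ℝ) * β| ≤ R * (K * ε) := by
      rw [abs_mul, abs_of_nonneg hn0]; gcongr
    have h2 : K * D ≤ (K + 1) ^ 2 * D := by gcongr; nlinarith only [hK0]
    have a1 := abs_le.1 hI1
    have a2 := abs_le.1 hflu
    have a3 := abs_le.1 h1
    rw [abs_le]
    constructor
    · linarith only [a1.1, a2.2, a3.1, h2, hAD, hBB, hB1]
    · linarith only [a1.2, a2.1, a3.2, h2, hAD, hBB, hB1]
  · have hpos : 0 ≤ 1 / R * ∫ x in (0 : ℝ)..R, F x ^ 2 := by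
      refine mul_nonneg (by positivity) (intervalIntegral.integral_nonneg hR.le fun _ _ => sq_nonneg _)
    have e3 : cramerDist R (translateNeg (imageMeasure k lam v) y) (scaledLeb Λ) ^ 2 - V =
        1 / R * ((∫ x in (0 : ℝ)..R, F x ^ 2) - R * V) := by
      rw [cramerDist, ← hF, Real.sq_sqrt hpos]; field_simp
    rw [e3]
    apply hfin
    have h1 : |2 * β * S1| ≤ 2 * K * D := by
      rw [abs_mul, abs_mul, abs_of_pos (by norm_num : (0 : ℝ) < 2)]
      have := mul_le_mul hβ1 hflu (abs_nonneg _) zero_le_one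
      linarith only [this]
    have h2 : (n : ℝ) * β ^ 2 ≤ R * (K * ε) := by gcongr
    have h3 : 0 ≤ (n : ℝ) * β ^ 2 := by positivity
    have h4 : 0 ≤ (R - n) * V := mul_nonneg (by linarith) hform0
    have h5 : (R - n) * V ≤ 1 * B ^ 2 := by
      apply mul_le_mul (by linarith) hform1 hform0 zero_le_one
    have h6 : 0 ≤ R * (K * ε) := by positivity
    have h7 : (K + 1) ^ 2 * D = K ^ 2 * D + 2 * K * D + D := by ring
    have a1 := abs_le.1 hI2
    have a2 := abs_le.1 hflu2
    have a3 := abs_le.1 h1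
    rw [abs_le]
    constructor
    · linarith only [a1.1, a2.1, a3.2, h2, h3, h4, h5, h6, h7, hAD, hD0]
    · linarith only [a1.2, a2.2, a3.1, h2, h3, h4, h5, h6, h7, hAD, hD0]

end Mean

/-! ### Integers with small errors -/

section SmallErrors

variable {d k : ℕ} {lam v : List (Fin d) → ℝ} {κ : ℝ} {H : ℕ}

/-- The preimage of `y` under the composition of the exact affine maps along the path from `w` to the
root. -/
noncomputable def exactPreimage (lam v : List (Fin d) → ℝ) (y : ℝ) (w : List (Fin d)) : ℝ :=
  if w = [] then y else (exactPreimage lam v y w.dropLast - v w) / lam w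
termination_by w.length
decreasing_by
  have := List.length_pos_iff.2 ‹_›
  rw [List.length_dropLast]; omega

theorem exactPreimage_nil (y : ℝ) : exactPreimage lam v y [] = y := by rw [exactPreimage]; simp

theorem exactPreimage_of_ne {w : List (Fin d)} (hw : w ≠ []) (y : ℝ) :
    exactPreimage lam v y w = (exactPreimage lam v y w.dropLast - v w) / lam w := by
  rw [exactPreimage, if_neg hw]

theorem Expanding.lam_le_prodMult (h : Expanding k lam) {w : List (Fin d)} (hw : w ≠ [])
    (hk : w.length ≤ k) : lam w ≤ prodMult lam w := by
  have hl := length_eq_dropLast_succ hw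
  rw [prodMult_eq hw]
  exact le_mul_of_one_le_right (by linarith [h w hw hk]) (h.one_le_prodMult _ (by omega))

/-- A translation which brings every exact preimage of `y` close to an integer produces an integer
with small errors. -/
theorem exists_hasSmallErrors (hlam : Expanding k lam) (hκ : 0 ≤ κ)
    (hret : HasReturns (fun w : Node d k => (prodMult lam w.1)⁻¹) κ H) {M ε : ℝ}
    (hM : ∀ w : List (Fin d), w ≠ [] → w.length ≤ k → prodMult lam w ≤ M)
    (hMε : 2 * κ * M ≤ min ε (1 / 4)) (y : ℤ) :
    ∃ y' : ℤ, |(y : ℝ) - y'| ≤ H ∧ HasSmallErrors k lam v ε y' := by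
  obtain ⟨h, hH, a, ha⟩ := hret fun w => -exactPreimage lam v y w.1
  obtain ⟨A, hA⟩ : ∃ A : List (Fin d) → ℤ,
      A = fun u => if hu : 1 ≤ u.length ∧ u.length ≤ k then a ⟨u, hu⟩ else y + h := ⟨_, rfl⟩
  have hA0 : A [] = y + h := by rw [hA]; simp
  have hAr : ∀ u : List (Fin d), u.length ≤ k →
      |h * (prodMult lam u)⁻¹ + exactPreimage lam v y u - A u| ≤ κ := by
    intro u hk
    by_cases hu : u = []
    · subst hu
      rw [hA0, prodMult_nil, exactPreimage_nil]
      have : (h : ℝ) * 1⁻¹ + y - (y + h : ℤ) = 0 := by push_cast; ring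
      rw [this, abs_zero]; exact hκ
    · have hu' : 1 ≤ u.length ∧ u.length ≤ k := ⟨List.length_pos_iff.2 hu, hk⟩
      have := ha ⟨u, hu'⟩
      rw [sub_neg_eq_add] at this
      simpa [hA, dif_pos hu'] using this
  have hstep : ∀ w : List (Fin d), w ≠ [] → w.length ≤ k →
      |((A w.dropLast : ℝ) + 1 / 2 - v w) / lam w - A w - 1 / (2 * lam w)| ≤ 2 * κ := by
    intro w hw hk
    have hl := length_eq_dropLast_succ hw
    have h1 := hAr w.dropLast (by omega)
    have h2 := hAr w hk
    have hlw := hlam w hw hk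
    have h3 : |(h * (prodMult lam w.dropLast)⁻¹ + exactPreimage lam v y w.dropLast -
        A w.dropLast) / lam w| ≤ κ := by
      rw [abs_div, abs_of_pos (by linarith : 0 < lam w)]
      exact (div_le_self (abs_nonneg _) hlw.le).trans h1
    have e : ((A w.dropLast : ℝ) + 1 / 2 - v w) / lam w - A w - 1 / (2 * lam w) =
        (h * (prodMult lam w)⁻¹ + exactPreimage lam v y w - A w) -
        (h * (prodMult lam w.dropLast)⁻¹ + exactPreimage lam v y w.dropLast -
        A w.dropLast) / lam w := by
      rw [prodMult_eq hw, exactPreimage_of_ne hw, mul_inv]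
      field_simp
      ring
    rw [e]
    refine (abs_sub _ _).trans ?_
    linarith
  have hκlam : ∀ w : List (Fin d), w ≠ [] → w.length ≤ k → 2 * κ * lam w ≤ min ε (1 / 4) := by
    intro w hw hk
    refine le_trans ?_ hMε
    have := (hlam.lam_le_prodMult hw hk).trans (hM w hw hk)
    gcongr
  have hback : ∀ w : List (Fin d), w.length ≤ k → backCount lam v w (y + h) = A w := by
    intro w
    induction w using dropLast_induction with
    | nil => intro _; rw [backCount_nil, hA0]
    | step w hw ih =>
      intro hk
      have hl := length_eq_dropLast_succ hw
      have hlw := hlam w hw hk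
      have h1 := abs_le.1 (hstep w hw hk)
      have h2 := (hκlam w hw hk).trans (min_le_right _ _)
      have h3 : 1 / (2 * lam w) ≤ 1 / 2 := by
        rw [div_le_div_iff₀ (by linarith) (by norm_num)]; linarith
      have h4 : 2 * κ < 1 / (2 * lam w) := by
        rw [lt_div_iff₀ (by linarith)]; nlinarith
      have h5 : 2 * κ * 1 ≤ 2 * κ * lam w := by gcongr
      rw [backCount_eq_iff hw, ih (by omega)]
      constructor <;> linarith
  refine ⟨y + h, ?_, hasSmallErrors_of_defect hlam fun w hw hk => ?_⟩
  · have : (y : ℝ) - (y + h : ℤ) = -h := by push_cast; ring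
    rw [this, abs_neg, Nat.abs_cast]
    exact_mod_cast hH
  · have hl := length_eq_dropLast_succ hw
    have hlw := hlam w hw hk
    have h1 := hstep w hw hk
    rw [← hback w hk, ← hback w.dropLast (by omega)] at h1
    have e : lam w * defect lam v w (y + h) - 1 / 2 = lam w *
        (((backCount lam v w.dropLast (y + h) : ℝ) + 1 / 2 - v w) / lam w -
          backCount lam v w (y + h) - 1 / (2 * lam w)) := by
      unfold defect; field_simp
    rw [e, abs_mul, abs_of_pos (by linarith)]
    refine le_trans ?_ (hκlam w hw hk)
    nlinarith

end SmallErrors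

/-! ### Density of the points close to half-integers -/

section Density

variable {d k : ℕ} {lam v : List (Fin d) → ℝ} {κ : ℝ} {H : ℕ}

/-- The translates of the near-half points by `q` return times are pairwise disjoint. -/
theorem mul_card_nearHalf_le {w : List (Fin d)} {q : ℕ} (hq : 0 < q)
    (hret : HasReturns (fun _ : Unit => lam w) (1 / (6 * q)) H) {S : Finset ℤ} {l u : ℤ}
    (hS : ∀ n ∈ S, l ≤ n ∧ n ≤ u ∧ Metric.infDist (affineMap lam v w n) halfIntegers < 1 / (3 * q))
    (hlu : l ≤ u) : (q * S.card : ℝ) ≤ u - l + 1 + H := by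
  have hq' : (0 : ℝ) < q := by exact_mod_cast hq
  choose h hH a ha using fun j : ℕ => hret fun _ => (j : ℝ) / q
  have hnear : ∀ n ∈ S, ∃ m : ℤ, |affineMap lam v w n - (m + 1 / 2)| < 1 / (3 * q) := by
    intro n hn
    have h1 := (hS n hn).2.2
    rw [Metric.infDist_lt_iff (⟨_, ⟨0, rfl⟩⟩ : halfIntegers.Nonempty)] at h1
    obtain ⟨_, ⟨m, rfl⟩, hm⟩ := h1
    exact ⟨m, by rwa [Real.dist_eq] at hm⟩
  have hcard : (Finset.range q ×ˢ S).card ≤ (Finset.Icc l (u + H)).card := by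
    refine Finset.card_le_card_of_injOn (fun p => p.2 + h p.1) ?_ ?_
    · rintro ⟨j, n⟩ hp
      have hp' := Finset.mem_product.1 hp
      have h1 := hS n hp'.2
      have h2 := hH j
      simp only [Finset.coe_Icc, mem_Icc]
      omega
    · rintro ⟨j, n⟩ hp ⟨j', n'⟩ hp' heq
      have hp1 := Finset.mem_product.1 hp
      have hp2 := Finset.mem_product.1 hp'
      simp only at heq hp1 hp2
      rw [Finset.mem_range] at hp1 hp2
      obtain ⟨m, hm⟩ := hnear n hp1.2
      obtain ⟨m', hm'⟩ := hnear n' hp2.2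
      have h1 := abs_lt.1 hm
      have h2 := abs_lt.1 hm'
      have h3 := abs_le.1 (ha j ())
      have h4 := abs_le.1 (ha j' ())
      obtain ⟨c, hc⟩ : ∃ c : ℤ, c = m' - m + a j' () - a j () := ⟨_, rfl⟩
      have h5 : |((((j : ℤ) - j' - q * c : ℤ)) : ℝ)| < 1 := by
        have e : (((j : ℤ) - j' - q * c : ℤ) : ℝ) = q * ((j / q - j' / q) - c) := by
          push_cast; field_simp
        have heq' : (n : ℝ) + h j = n' + h j' := by exact_mod_cast heq
        have e2 : lam w * n + lam w * h j = lam w * n' + lam w * h j' := by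
          rw [← mul_add, ← mul_add, heq']
        have e3 : (1 : ℝ) / (3 * q) = 1 / q / 3 := by field_simp
        have e4 : (1 : ℝ) / (6 * q) = 1 / q / 6 := by field_simp
        unfold affineMap at h1 h2
        rw [e3] at h1 h2
        rw [e4] at h3 h4
        have h6 : |((j : ℝ) / q - j' / q) - c| < 1 / q := by
          rw [hc]
          push_cast
          rw [abs_lt]
          constructor <;> linarith [h1.1, h1.2, h2.1, h2.2, h3.1, h3.2, h4.1, h4.2]
        rw [e, abs_mul, abs_of_pos hq']
        calc _ < (q : ℝ) * (1 / q) := by gcongr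
          _ = 1 := by field_simp
      have h7 : (j : ℤ) - j' - q * c = 0 := by
        rw [← Int.abs_lt_one_iff]; exact_mod_cast h5
      have h8 : (q : ℤ) ∣ j - j' := ⟨c, by linarith⟩
      have h9 := Int.eq_zero_of_abs_lt_dvd h8 (by rw [abs_lt]; omega)
      have h10 : j = j' := by omega
      subst h10
      rw [Prod.mk.injEq]
      exact ⟨rfl, by linarith⟩
  rw [Finset.card_product, Finset.card_range, Int.card_Icc] at hcard
  have h1 : ((q * S.card : ℕ) : ℤ) ≤ u + H + 1 - l := by omega
  have h2 : ((((q * S.card : ℕ) : ℤ)) : ℝ) ≤ ((u + H + 1 - l : ℤ) : ℝ) := by exact_mod_cast h1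
  push_cast at h2
  linarith

theorem upperDensity_nearHalf_lt {w : List (Fin d)} {q : ℕ} (hq : 0 < q)
    (hret : HasReturns (fun _ : Unit => lam w) (1 / (6 * q)) H) {δ : ℝ} (hδ : 0 < δ)
    (hlam : 1 + δ ≤ lam w) {R : ℝ} (hR : (2 + H) * (1 + δ) / δ ≤ R) :
    upperDensity R (nearHalf lam v w (1 / (3 * q))) < ENNReal.ofReal (1 / q) := by
  have hq' : (0 : ℝ) < q := by exact_mod_cast hq
  have hl0 : 0 < lam w := by linarith
  obtain ⟨θ, hθ⟩ : ∃ θ, θ = (1 + 1 / (1 + δ)) / 2 := ⟨_, rfl⟩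
  have hδ1 : 1 / (1 + δ) < 1 := by rw [div_lt_one (by linarith)]; linarith
  have hδ0 : 0 < 1 / (1 + δ) := by positivity
  have hθ1 : θ < 1 := by linarith
  have hθ0 : 0 < θ := by linarith
  have hR0 : 0 < R := lt_of_lt_of_le (by positivity) hR
  have hmain : 2 * R / lam w + 1 + H ≤ θ * (2 * R - 1) := by
    have h1 : 2 * R / lam w ≤ 2 * R * (1 / (1 + δ)) := by
      rw [div_eq_mul_one_div]; gcongr
    have h2 : θ - 1 / (1 + δ) = δ / (1 + δ) / 2 := by rw [hθ]; field_simp; ring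
    have h3 : (2 + H : ℝ) ≤ R * (δ / (1 + δ)) := by
      rw [div_le_iff₀ hδ] at hR
      rw [mul_div_assoc', le_div_iff₀ (by linarith)]
      linarith
    nlinarith
  refine lt_of_le_of_lt (iSup_le fun x => ?_)
    ((ENNReal.ofReal_lt_ofReal_iff (by positivity)).2 (by gcongr : θ / q < 1 / q))
  apply ENNReal.div_le_of_le_mul
  classical
  set l : ℤ := ⌈(x - R - v w) / lam w⌉
  set u : ℤ := ⌊(x + R - v w) / lam w⌋
  set S : Finset ℤ := (Finset.Icc l u).filter fun n : ℤ =>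
    Metric.infDist (affineMap lam v w n) halfIntegers < 1 / (3 * q) with hS
  have hsub : nearHalf lam v w (1 / (3 * q)) ∩ Icc (x - R) (x + R) ⊆
      (fun n : ℤ => affineMap lam v w n) '' S := by
    rintro _ ⟨⟨⟨n, rfl⟩, hn⟩, h1, h2⟩
    refine ⟨n, ?_, rfl⟩
    rw [hS, Finset.mem_coe, Finset.mem_filter, Finset.mem_Icc]
    simp only [affineMap] at h1 h2
    refine ⟨⟨Int.ceil_le.2 ?_, Int.le_floor.2 ?_⟩, hn⟩
    · rw [div_le_iff₀ hl0]; linarith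
    · rw [le_div_iff₀ hl0]; linarith
  have hnum : (nearHalf lam v w (1 / (3 * q)) ∩ Icc (x - R) (x + R)).encard ≤ (S.card : ℕ∞) := by
    refine (encard_le_encard hsub).trans ((encard_image_le _ _).trans ?_)
    rw [encard_coe_eq_coe_finsetCard]
  set D : Finset ℤ := Finset.Icc ⌈x - R⌉ ⌊x + R⌋ with hD
  have hden : (D.card : ℕ∞) ≤ (range (fun n : ℤ => (n : ℝ)) ∩ Icc (x - R) (x + R)).encard := by
    rw [← encard_coe_eq_coe_finsetCard,
      ← (Int.cast_injective (α := ℝ)).encard_image (D : Set ℤ)]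
    refine encard_le_encard ?_
    rintro _ ⟨n, hn, rfl⟩
    rw [hD, Finset.mem_coe, Finset.mem_Icc, Int.ceil_le, Int.le_floor] at hn
    exact ⟨⟨n, rfl⟩, hn⟩
  have hDcard : 2 * R - 1 ≤ (D.card : ℝ) := by
    rw [hD, Int.card_Icc]
    have h1 : ⌊x + R⌋ + 1 - ⌈x - R⌉ ≤ ((⌊x + R⌋ + 1 - ⌈x - R⌉).toNat : ℤ) := Int.self_le_toNat _
    have h2 : ((⌊x + R⌋ + 1 - ⌈x - R⌉ : ℤ) : ℝ) ≤ (((⌊x + R⌋ + 1 - ⌈x - R⌉).toNat : ℤ) : ℝ) := by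
      exact_mod_cast h1
    push_cast at h2
    have h3 := Int.lt_floor_add_one (x + R)
    have h4 := Int.ceil_lt_add_one (x - R)
    linarith
  have hScard : (q * S.card : ℝ) ≤ 2 * R / lam w + 1 + H := by
    rcases S.eq_empty_or_nonempty with h0 | ⟨n, hn⟩
    · rw [h0]; simp only [Finset.card_empty, Nat.cast_zero, mul_zero]; positivity
    · have hn' := Finset.mem_Icc.1 (Finset.mem_filter.1 hn).1
      have h1 := mul_card_nearHalf_le (v := v) hq hret (S := S) (l := l) (u := u) (fun n hn => by
        have := Finset.mem_filter.1 hn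
        have h2 := Finset.mem_Icc.1 this.1
        exact ⟨h2.1, h2.2, this.2⟩) (hn'.1.trans hn'.2)
      have h2 : (u : ℝ) ≤ (x + R - v w) / lam w := Int.floor_le _
      have h3 : (x - R - v w) / lam w ≤ l := Int.le_ceil _
      have h4 : (x + R - v w) / lam w - (x - R - v w) / lam w = 2 * R / lam w := by ring
      linarith
  have hfin : (S.card : ℝ) ≤ θ / q * D.card := by
    rw [div_mul_eq_mul_div, le_div_iff₀ hq']
    nlinarith
  calc ((nearHalf lam v w (1 / (3 * q)) ∩ Icc (x - R) (x + R)).encard : ℝ≥0∞)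
      ≤ ((S.card : ℕ∞) : ℝ≥0∞) := by exact_mod_cast hnum
    _ = ENNReal.ofReal S.card := by simp
    _ ≤ ENNReal.ofReal (θ / q * D.card) := ENNReal.ofReal_le_ofReal hfin
    _ = ENNReal.ofReal (θ / q) * ((D.card : ℕ∞) : ℝ≥0∞) := by
        rw [ENNReal.ofReal_mul (by positivity)]; simp
    _ ≤ _ := by gcongr

/-- Resonances of a single multiplier are resonances of the inverse products. -/
theorem NonResonant.le_abs_mul_lam_sub {N N₁ M : ℕ} {δ : ℝ} (hlam : Expanding k lam)
    (hres : NonResonant (fun w : Node d k => (prodMult lam w.1)⁻¹) N δ) (hδ : δ ≤ 1)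
    {w : List (Fin d)} (hw : w ≠ []) (hk : w.length ≤ k) (hM : prodMult lam w ≤ M)
    (hN : N₁ * M + 1 ≤ N) {a : ℤ} (ha : a ≠ 0) (haN : |a| ≤ N₁) (m : ℤ) :
    δ ≤ |a * lam w - m| := by
  classical
  have hl := length_eq_dropLast_succ hw
  have hlw := hlam w hw hk
  have hz := hlam.one_lt_prodMult hw hk
  have hM1 : (1 : ℝ) < M := hz.trans_le hM
  have hM1' : 1 ≤ M := by exact_mod_cast hM1.le
  have haN' : |(a : ℝ)| ≤ N₁ := by exact_mod_cast haN
  have ha1 : (1 : ℝ) ≤ |(a : ℝ)| := by exact_mod_cast Int.one_le_abs ha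
  have haN2 : |a| ≤ N := haN.trans (by
    have : N₁ ≤ N₁ * M := Nat.le_mul_of_pos_right _ hM1'
    exact_mod_cast (by omega : N₁ ≤ N))
  have hwn : 1 ≤ w.length ∧ w.length ≤ k := ⟨List.length_pos_iff.2 hw, hk⟩
  rcases lt_or_ge (N : ℤ) |m| with hm | hm
  · have h1 : |(a : ℝ) * lam w| ≤ N₁ * M := by
      rw [abs_mul, abs_of_pos (by linarith : 0 < lam w)]
      have := (hlam.lam_le_prodMult hw hk).trans hM
      gcongr
    have h2 : (N : ℝ) < |(m : ℝ)| := by exact_mod_cast hm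
    have h3 : (N₁ * M + 1 : ℝ) ≤ N := by exact_mod_cast hN
    have h4 := abs_sub_abs_le_abs_sub (m : ℝ) (a * lam w)
    rw [abs_sub_comm] at h4
    linarith
  · -- Multiplying by the product at `w` turns a relation for the inverse products into one for `lam w`.
    suffices hs : ∃ X : ℝ, δ ≤ |X| ∧ a * lam w - m = prodMult lam w * X by
      obtain ⟨X, hX, e⟩ := hs
      rw [e, abs_mul, abs_of_pos (by linarith)]
      exact hX.trans (le_mul_of_one_le_left (abs_nonneg _) hz.le)
    by_cases hp : w.dropLast = []
    · have hlz : prodMult lam w = lam w := by rw [prodMult_eq hw, hp, prodMult_nil, mul_one]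
      by_cases hm0 : m = 0
      · refine ⟨a, hδ.trans ha1, ?_⟩
        rw [hm0, hlz]; push_cast; ring
      · have h1 := hres (Pi.single ⟨w, hwn⟩ (-m)) (by simpa using hm0) (by
          intro u
          by_cases hu : u = ⟨w, hwn⟩
          · subst hu; simpa using hm
          · rw [Pi.single_eq_of_ne hu]; simp) (-a)
        rw [Finset.sum_eq_single ⟨w, hwn⟩ (by intro b _ hb; simp [Pi.single_eq_of_ne hb]) (by simp)]
          at h1
        refine ⟨_, h1, ?_⟩
        simp only [Pi.single_eq_same]
        rw [hlz]; push_cast; field_simp; ring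
    · have hpn : 1 ≤ w.dropLast.length ∧ w.dropLast.length ≤ k :=
        ⟨List.length_pos_iff.2 hp, by omega⟩
      have hne : (⟨w.dropLast, hpn⟩ : Node d k) ≠ ⟨w, hwn⟩ := by
        intro h
        have := congrArg (fun u : Node d k => u.1.length) h
        simp only at this
        omega
      have h1 := hres (Pi.single ⟨w.dropLast, hpn⟩ a + Pi.single ⟨w, hwn⟩ (-m)) (by
          intro h
          have := congrFun h ⟨w.dropLast, hpn⟩
          rw [Pi.add_apply, Pi.single_eq_same, Pi.single_eq_of_ne hne] at this
          simp at this
          exact ha this) (by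
          intro u
          rw [Pi.add_apply]
          by_cases hu : u = ⟨w, hwn⟩
          · subst hu; rw [Pi.single_eq_same, Pi.single_eq_of_ne hne.symm]; simpa using hm
          · rw [Pi.single_eq_of_ne hu, add_zero]
            by_cases hu' : u = ⟨w.dropLast, hpn⟩
            · subst hu'; rw [Pi.single_eq_same]; exact haN2
            · rw [Pi.single_eq_of_ne hu']; simp) 0
      refine ⟨_, h1, ?_⟩
      simp only [Pi.add_apply, Int.cast_add, add_mul, Finset.sum_add_distrib]
      rw [Finset.sum_eq_single ⟨w.dropLast, hpn⟩ (by intro b _ hb; simp [Pi.single_eq_of_ne hb])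
        (by simp), Finset.sum_eq_single ⟨w, hwn⟩ (by intro b _ hb; simp [Pi.single_eq_of_ne hb])
        (by simp)]
      simp only [Pi.single_eq_same]
      have hz' := hlam.one_le_prodMult w.dropLast (by omega)
      rw [prodMult_eq hw]
      push_cast
      field_simp
      ring

theorem NonResonant.multiplier {N N₁ M : ℕ} {δ : ℝ} (hlam : Expanding k lam)
    (hres : NonResonant (fun w : Node d k => (prodMult lam w.1)⁻¹) N δ) (hδ : δ ≤ 1)
    {w : List (Fin d)} (hw : w ≠ []) (hk : w.length ≤ k) (hM : prodMult lam w ≤ M)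
    (hN : N₁ * M + 1 ≤ N) : NonResonant (fun _ : Unit => lam w) N₁ δ := by
  intro n hn hnN m
  simp only [Finset.univ_unique, Finset.sum_singleton]
  refine hres.le_abs_mul_lam_sub hlam hδ hw hk hM hN ?_ (hnN _) m
  intro h0
  exact hn (funext fun u => h0)

end Density

/-! ### The resonance hypersurfaces -/

section Geometry

variable {d k : ℕ}

theorem isOpen_multiplierSpace : IsOpen (multiplierSpace d k) := by
  have : multiplierSpace d k = ⋂ w : Node d k, {z | 1 < z w} := by
    ext z; simp [multiplierSpace]
  rw [this]
  exact isOpen_iInter_of_finite fun w => isOpen_lt continuous_const (by fun_prop)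

theorem hasFDerivAt_sum_mul_inv (n : Node d k → ℝ) (r : ℝ) {z : EuclideanSpace ℝ (Node d k)}
    (hz : ∀ w, z w ≠ 0) :
    HasFDerivAt (fun z : EuclideanSpace ℝ (Node d k) => ∑ w, n w * (z w)⁻¹ - r)
      (∑ w, n w • (-((z w) ^ 2)⁻¹) • (EuclideanSpace.proj w : EuclideanSpace ℝ (Node d k) →L[ℝ] ℝ))
      z := by
  have h1 : ∀ w, HasFDerivAt (fun z : EuclideanSpace ℝ (Node d k) => z w)
      (EuclideanSpace.proj w : EuclideanSpace ℝ (Node d k) →L[ℝ] ℝ) z := fun w =>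
    (EuclideanSpace.proj w : EuclideanSpace ℝ (Node d k) →L[ℝ] ℝ).hasFDerivAt
  exact (HasFDerivAt.fun_sum fun w _ =>
    (((hasDerivAt_inv (hz w)).comp_hasFDerivAt z (h1 w)).const_mul (n w))).sub_const r

theorem isPosCodimSubmanifold_resonance {O : Set (EuclideanSpace ℝ (Node d k))} (hO : IsOpen O)
    (hsub : O ⊆ multiplierSpace d k) {n : Node d k → ℝ} (hn : n ≠ 0) (r : ℝ) :
    IsPosCodimSubmanifold {z | z ∈ O ∧ ∑ w, n w * (z w)⁻¹ = r} := by
  classical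
  rintro x ⟨hxO, hx⟩
  have h0 : ∀ z ∈ O, ∀ w, z w ≠ 0 := fun z hz w => (one_pos.trans (hsub hz w)).ne'
  obtain ⟨e, he⟩ : ∃ e : EuclideanSpace ℝ (Fin 1), e = EuclideanSpace.single 0 1 := ⟨_, rfl⟩
  have he0 : ∀ y : EuclideanSpace ℝ (Fin 1), y = y 0 • e := by
    intro y; ext i; rw [he]; fin_cases i; simp
  refine ⟨1, le_rfl, O, hO, hxO, fun z => (∑ w, n w * (z w)⁻¹ - r) • e, ?_, ?_, ?_⟩
  · have hp : ∀ w, ContDiffOn ℝ ∞ (fun z : EuclideanSpace ℝ (Node d k) => z w) O := fun w =>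
      (EuclideanSpace.proj w : EuclideanSpace ℝ (Node d k) →L[ℝ] ℝ).contDiff.contDiffOn
    have hf : ContDiffOn ℝ ∞
        (fun z : EuclideanSpace ℝ (Node d k) => ∑ w, n w * (z w)⁻¹ - r) O :=
      (ContDiffOn.sum fun w _ =>
        contDiffOn_const.mul ((hp w).inv fun z hz => h0 z hz w)).sub contDiffOn_const
    exact hf.smul contDiffOn_const
  · intro z hz
    rw [((hasFDerivAt_sum_mul_inv n r (h0 z hz)).smul_const e).fderiv]
    intro y
    obtain ⟨w, hw⟩ := Function.ne_iff.1 hn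
    have hzw := h0 z hz w
    have hw' : n w ≠ 0 := hw
    refine ⟨EuclideanSpace.single w (-(y 0 * (z w) ^ 2 / n w)), ?_⟩
    rw [ContinuousLinearMap.smulRight_apply, he0 y]
    congr 1
    simp only [sum_apply, smul_apply, smul_eq_mul]
    rw [Finset.sum_eq_single w (by intro b _ hb; simp [hb]) (by simp), ← he0 y]
    simp
    field_simp
  · intro z hz
    have hene : e ≠ 0 := by
      rw [he]; intro h
      have := congrArg (fun y : EuclideanSpace ℝ (Fin 1) => y 0) h
      simp at this
    simp only [mem_ofPred_eq, hz, true_and, smul_eq_zero, hene, or_false, sub_eq_zero]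

/-- The values at which single coordinates are cut: they accumulate at `1` on one side and become
denser and denser at infinity on the other. -/
noncomputable def cutValue (b : Bool) (j : ℕ) : ℝ :=
  if b then 1 + 1 / (j + 1) else Real.sqrt (j + 1)

/-- The indices of the hypersurfaces: cuts of single coordinates, and resonances `(M, n, m)`. -/
abbrev ResonanceIndex (d k : ℕ) : Type := (Node d k × Bool × ℕ) ⊕ (ℕ × (Node d k → ℤ) × ℤ)

/-- The hypersurfaces of the theorem. Those of the first kind keep the coordinates in a compact part
of `]1, +∞[`. Those of the second kind are the integer relations between `1` and the inverse
coordinates; a relation of size at most `N M` is removed only where some coordinate exceeds `M - 2`,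
which makes the family locally finite whatever the growth of `N`. -/
def resonanceSet (N : ℕ → ℕ) : ResonanceIndex d k → Set (EuclideanSpace ℝ (Node d k))
  | .inl (w, b, j) => {z | z ∈ multiplierSpace d k ∧ z w = cutValue b j}
  | .inr (M, n, m) => {z | (z ∈ multiplierSpace d k ∧ ∃ w, (M : ℝ) < z w + 2) ∧
      (n ≠ 0 ∧ ∀ w, |n w| ≤ N M) ∧ ∑ w, n w * (z w)⁻¹ = m}

theorem resonanceSet_subset (N : ℕ → ℕ) (i : ResonanceIndex d k) :
    resonanceSet N i ⊆ multiplierSpace d k := by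
  rcases i with ⟨w, b, j⟩ | ⟨M, n, m⟩
  · exact fun z hz => hz.1
  · exact fun z hz => hz.1.1

theorem isPosCodimSubmanifold_resonanceSet (N : ℕ → ℕ) (i : ResonanceIndex d k) :
    IsPosCodimSubmanifold (resonanceSet N i) := by
  classical
  rcases i with ⟨w, b, j⟩ | ⟨M, n, m⟩
  · convert! isPosCodimSubmanifold_resonance isOpen_multiplierSpace Subset.rfl
      (n := Pi.single w 1) (by simp) (cutValue b j)⁻¹ using 1
    ext z
    simp only [resonanceSet, mem_ofPred_eq]
    rw [Finset.sum_eq_single w (by intro u _ hu; simp [Pi.single_eq_of_ne hu]) (by simp)]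
    simp
  · by_cases hn : n ≠ 0 ∧ ∀ w, |n w| ≤ N M
    · have hO : IsOpen {z : EuclideanSpace ℝ (Node d k) | ∃ w, (M : ℝ) < z w + 2} := by
        have : {z : EuclideanSpace ℝ (Node d k) | ∃ w, (M : ℝ) < z w + 2} =
            ⋃ w, {z | (M : ℝ) < z w + 2} := by ext z; simp
        rw [this]
        exact isOpen_iUnion fun w => isOpen_lt continuous_const (by fun_prop)
      have hn0 : (fun w => (n w : ℝ)) ≠ 0 := by
        intro h; apply hn.1; funext w
        have := congrFun h w
        simpa using this
      convert! isPosCodimSubmanifold_resonance (isOpen_multiplierSpace.inter hO)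
        inter_subset_left hn0 m using 1
      ext z
      simp only [resonanceSet, mem_ofPred_eq, mem_inter_iff, and_iff_right hn]
    · intro x hx
      exact absurd hx.2.1 hn

theorem finite_resonanceSet_inter (N : ℕ → ℕ) {z : EuclideanSpace ℝ (Node d k)}
    (hz : z ∈ multiplierSpace d k) :
    ∃ U ∈ 𝓝 z, {i | (resonanceSet N i ∩ U).Nonempty}.Finite := by
  classical
  -- A common margin `a` below and bound `B` above for the coordinates.
  obtain ⟨a, ha0, ha⟩ : ∃ a : ℝ, 0 < a ∧ ∀ w, 1 + a < z w := by
    by_cases hne : Nonempty (Node d k)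
    · obtain ⟨w0, hw0⟩ := Finite.exists_min fun w => z w
      refine ⟨(z w0 - 1) / 2, by linarith [hz w0], fun w => by linarith [hz w0, hw0 w]⟩
    · exact ⟨1, one_pos, fun w => absurd ⟨w⟩ hne⟩
  obtain ⟨B, hB⟩ : ∃ B : ℕ, ∀ w, z w < B := by
    obtain ⟨b, hb⟩ := (Set.finite_range fun w => z w).bddAbove
    obtain ⟨B, hB⟩ := exists_nat_gt b
    exact ⟨B, fun w => (hb ⟨w, rfl⟩).trans_lt hB⟩
  refine ⟨⋂ w, {x : EuclideanSpace ℝ (Node d k) | 1 + a < x w ∧ x w < B}, ?_, ?_⟩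
  · refine IsOpen.mem_nhds (isOpen_iInter_of_finite fun w => ?_) (mem_iInter.2 fun w => ⟨ha w, hB w⟩)
    have hw : Continuous fun x : EuclideanSpace ℝ (Node d k) => x w := by fun_prop
    exact (isOpen_lt continuous_const hw).inter (isOpen_lt hw continuous_const)
  obtain ⟨J, hJ⟩ := exists_nat_gt (1 / a)
  obtain ⟨T, hT⟩ : ∃ T : ℕ, T = ∑ M ∈ Finset.range (B + 2), N M := ⟨_, rfl⟩
  obtain ⟨C, hC⟩ : ∃ C : ℕ, C = Fintype.card (Node d k) * T := ⟨_, rfl⟩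
  have hfin1 : ((Set.univ : Set (Node d k)) ×ˢ (Set.univ : Set Bool) ×ˢ Set.Iic (J + B ^ 2)).Finite :=
    Set.finite_univ.prod (Set.finite_univ.prod (Set.finite_Iic _))
  have hfin2 : (Set.Iio (B + 2) ×ˢ Set.Icc (fun _ : Node d k => -(T : ℤ)) (fun _ => (T : ℤ)) ×ˢ
      Set.Icc (-(C : ℤ)) C).Finite :=
    (Set.finite_Iio _).prod ((Set.finite_Icc _ _).prod (Set.finite_Icc _ _))
  refine ((hfin1.image Sum.inl).union (hfin2.image Sum.inr)).subset ?_
  rintro (⟨w, b, j⟩ | ⟨M, n, m⟩) ⟨x, hx, hxU⟩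
  · left
    refine ⟨_, ⟨mem_univ _, mem_univ _, ?_⟩, rfl⟩
    have h1 := mem_iInter.1 hxU w
    have h2 := hx.2
    simp only [mem_ofPred_eq] at h1
    rw [h2] at h1
    unfold cutValue at h1
    simp only [mem_Iic]
    cases b
    · simp only [Bool.false_eq_true, if_false] at h1
      have hB0 : (0 : ℝ) ≤ B := Nat.cast_nonneg B
      have h3 := (Real.sqrt_lt' (lt_of_le_of_lt (Real.sqrt_nonneg _) h1.2)).1 h1.2
      have h4 : j + 1 < B ^ 2 := by exact_mod_cast h3
      omega
    · simp only [if_true] at h1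
      have h3 : a < 1 / (j + 1) := by linarith [h1.1]
      rw [lt_div_iff₀ (by positivity), mul_comm, ← lt_div_iff₀ ha0] at h3
      have h4 : ((j + 1 : ℕ) : ℝ) < J := by push_cast; linarith
      have h5 : j + 1 < J := by exact_mod_cast h4
      omega
  · right
    obtain ⟨⟨hxS, w, hMw⟩, ⟨hn0, hn⟩, hsum⟩ := hx
    have h1 := mem_iInter.1 hxU w
    have hMB : M < B + 2 := by
      have : (M : ℝ) < ((B + 2 : ℕ) : ℝ) := by push_cast; linarith [h1.2]
      exact_mod_cast this
    have hNT : N M ≤ T := by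
      rw [hT]; exact Finset.single_le_sum (fun _ _ => Nat.zero_le _) (Finset.mem_range.2 hMB)
    have hnT : ∀ w, |n w| ≤ T := fun w => (hn w).trans (by exact_mod_cast hNT)
    have hm : |(m : ℝ)| ≤ C := by
      rw [← hsum, hC]
      refine (Finset.abs_sum_le_sum_abs _ _).trans ?_
      push_cast
      rw [← nsmul_eq_mul, Fintype.card]
      refine Finset.sum_le_card_nsmul _ _ _ fun u _ => ?_
      have h2 : |(n u : ℝ)| ≤ T := by exact_mod_cast hnT u
      have h3 := hxS u
      rw [abs_mul, abs_inv, abs_of_pos (by linarith : 0 < x u)]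
      exact (mul_le_of_le_one_right (abs_nonneg _) (inv_le_one_of_one_le₀ h3.le)).trans h2
    have hm' : |m| ≤ C := by exact_mod_cast hm
    refine ⟨_, ⟨mem_Iio.2 hMB, ⟨fun u => (abs_le.1 (hnT u)).1, fun u => (abs_le.1 (hnT u)).2⟩,
      abs_le.1 hm'⟩, rfl⟩

/-- The family `resonanceSet N` numbered by the natural numbers. -/
theorem exists_isLocFiniteSubmanifolds (N : ℕ → ℕ) :
    ∃ V : ℕ → Set (EuclideanSpace ℝ (Node d k)), IsLocFiniteSubmanifolds V ∧
      ∀ i : ResonanceIndex d k, ∃ q, V q = resonanceSet N i := by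
  obtain ⟨f, hf⟩ := Countable.exists_injective_nat (ResonanceIndex d k)
  have hcase : ∀ q, (∃ i, f i = q ∧ Function.extend f (resonanceSet N) (fun _ => ∅) q =
      resonanceSet N i) ∨ Function.extend f (resonanceSet N) (fun _ => ∅) q = ∅ := by
    intro q
    by_cases h : ∃ i, f i = q
    · obtain ⟨i, rfl⟩ := h
      exact Or.inl ⟨i, rfl, hf.extend_apply _ _ _⟩
    · exact Or.inr (Function.extend_apply' _ _ _ h)
  refine ⟨Function.extend f (resonanceSet N) (fun _ => ∅), ⟨fun q => ?_, fun q => ?_, fun z hz => ?_⟩,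
    fun i => ⟨f i, hf.extend_apply _ _ _⟩⟩
  · rcases hcase q with ⟨i, -, h⟩ | h <;> rw [h]
    · exact resonanceSet_subset N i
    · exact empty_subset _
  · rcases hcase q with ⟨i, -, h⟩ | h <;> rw [h]
    · exact isPosCodimSubmanifold_resonanceSet N i
    · exact fun x hx => absurd hx (notMem_empty x)
  · obtain ⟨U, hU, hfin⟩ := finite_resonanceSet_inter N hz
    refine ⟨U, hU, (hfin.image f).subset ?_⟩
    rintro q hq
    rcases hcase q with ⟨i, rfl, h⟩ | h
    · rw [mem_ofPred_eq, h] at hq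
      exact ⟨i, hq, rfl⟩
    · rw [mem_ofPred_eq, h, empty_inter] at hq
      exact absurd hq not_nonempty_empty

theorem dist_update (z : EuclideanSpace ℝ (Node d k)) [DecidableEq (Node d k)] (w : Node d k)
    (t : ℝ) : dist z (WithLp.toLp 2 (Function.update z.ofLp w t)) = |z w - t| := by
  rw [EuclideanSpace.dist_eq, Finset.sum_eq_single w]
  · simp [Real.dist_eq, Real.sqrt_sq_eq_abs]
  · intro u _ hu; simp [Function.update_of_ne hu]
  · simp

/-- Away from the cuts of the first kind all coordinates lie in a compact part of `]1, +∞[`. -/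
theorem mem_of_far_of_cuts {N : ℕ → ℕ} {η : ℝ} (hη : 0 < η) (hη2 : η ≤ 1 / 2)
    {z : EuclideanSpace ℝ (Node d k)} (hz : z ∈ multiplierSpace d k)
    (hfar : ∀ i : ResonanceIndex d k, ∀ x ∈ resonanceSet N i, η < dist z x) (w : Node d k) :
    1 + η < z w ∧ z w < 1 / η := by
  classical
  have key : ∀ b j, 1 < cutValue b j → η < |z w - cutValue b j| := by
    intro b j h1
    rw [← dist_update]
    refine hfar (.inl (w, b, j)) _ ⟨fun u => ?_, by simp⟩
    by_cases hu : u = w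
    · subst hu; simpa using h1
    · simpa [Function.update_of_ne hu] using hz u
  have hzw := hz w
  constructor
  · by_contra! hcon
    obtain ⟨j, hj⟩ := exists_nat_one_div_lt hη
    have hj0 : (0 : ℝ) < 1 / (j + 1) := by positivity
    have h1 := key true j (by simp only [cutValue, if_true]; linarith)
    simp only [cutValue, if_true] at h1
    rw [lt_abs] at h1
    rcases h1 with h1 | h1 <;> linarith
  · by_contra! hcon
    rw [div_le_iff₀ hη] at hcon
    have hz2 : 2 ≤ z w := by nlinarith
    -- The cut at the root of the integer part of `z w ^ 2`.
    obtain ⟨j, hj⟩ : ∃ j, j = ⌊z w ^ 2⌋₊ - 1 := ⟨_, rfl⟩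
    have hfl : 4 ≤ ⌊z w ^ 2⌋₊ := Nat.le_floor (by push_cast; nlinarith)
    have hjr : (j : ℝ) + 1 = ⌊z w ^ 2⌋₊ := by
      have : j + 1 = ⌊z w ^ 2⌋₊ := by omega
      exact_mod_cast this
    have h2 := Nat.floor_le (sq_nonneg (z w))
    have h3 := Nat.lt_floor_add_one (z w ^ 2)
    have hs0 := Real.sqrt_nonneg ((j : ℝ) + 1)
    have hs2 := Real.sq_sqrt (by positivity : (0 : ℝ) ≤ (j : ℝ) + 1)
    have hle : Real.sqrt (j + 1) ≤ z w := by
      rw [Real.sqrt_le_left (by linarith), hjr]; exact h2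
    have hfl' : (4 : ℝ) ≤ ⌊z w ^ 2⌋₊ := by exact_mod_cast hfl
    have h1 := key false j (by
      simp only [cutValue, Bool.false_eq_true, if_false]
      rw [Real.lt_sqrt (by norm_num), hjr]
      linarith)
    simp only [cutValue, Bool.false_eq_true, if_false] at h1
    rw [abs_of_nonneg (by linarith)] at h1
    nlinarith

/-- Away from the resonance hypersurfaces the inverse coordinates are nonresonant, at an order depending
on a bound `M` for the coordinates, which itself is bounded in terms of the distance. -/
theorem nonResonant_of_far {N : ℕ → ℕ} {η : ℝ} (hη : 0 < η) (hη2 : η ≤ 1 / 2)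
    {z : EuclideanSpace ℝ (Node d k)} (hz : z ∈ multiplierSpace d k)
    (hfar : ∀ i : ResonanceIndex d k, ∀ x ∈ resonanceSet N i, η < dist z x) {T : ℕ}
    (hT : 1 / η ≤ T) :
    ∃ M ≤ T, (∀ w, z w ≤ M) ∧ NonResonant (fun w => (z w)⁻¹) (N M) (η ^ 3 / 2) := by
  classical
  have hmem := mem_of_far_of_cuts hη hη2 hz hfar
  by_cases hne : Nonempty (Node d k)
  swap
  · refine ⟨T, le_rfl, fun w => absurd ⟨w⟩ hne, fun n hn => ?_⟩
    exact absurd (funext fun w => absurd ⟨w⟩ hne) hn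
  obtain ⟨w0, hw0⟩ := Finite.exists_max fun w => z w
  refine ⟨⌈z w0⌉₊, Nat.ceil_le.2 ((hmem w0).2.le.trans hT), fun w => (hw0 w).trans (Nat.le_ceil _),
    fun n hn hnN m => ?_⟩
  by_contra! hcon
  obtain ⟨w, hw⟩ := Function.ne_iff.1 hn
  have hw' : n w ≠ 0 := hw
  have hnw : (1 : ℝ) ≤ |(n w : ℝ)| := by exact_mod_cast Int.one_le_abs hw'
  have hnw0 : (n w : ℝ) ≠ 0 := by exact_mod_cast hw'
  obtain ⟨h1, h2⟩ := hmem w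
  have hzw : 0 < z w := by linarith
  -- Correct the defect of the relation by moving the inverse of one coordinate by `s`.
  obtain ⟨s, hs⟩ : ∃ s : ℝ, s = (m - ∑ u, n u * (z u)⁻¹) / n w := ⟨_, rfl⟩
  have hs1 : |s| < η ^ 3 / 2 := by
    rw [hs, abs_div, abs_sub_comm]
    exact (div_le_self (abs_nonneg _) hnw).trans_lt hcon
  have hinv : η < (z w)⁻¹ := by
    rw [lt_inv_comm₀ hη hzw, ← one_div]; exact h2
  have hη3 : η ^ 3 / 2 ≤ η / 2 := by
    have : η ^ 2 ≤ 1 := by nlinarith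
    nlinarith
  have hs2 := abs_lt.1 hs1
  have hpos : η / 2 < (z w)⁻¹ + s := by linarith
  obtain ⟨t, ht⟩ : ∃ t : ℝ, t = ((z w)⁻¹ + s)⁻¹ := ⟨_, rfl⟩
  have ht0 : 0 < t := by rw [ht]; exact inv_pos.2 (by linarith)
  have hdist : |z w - t| ≤ η := by
    have e : z w - t = s * (z w * t) := by
      have h3 : (z w)⁻¹ + s ≠ 0 := by linarith
      have h11 : t * ((z w)⁻¹ + s) = 1 := by rw [ht]; exact inv_mul_cancel₀ h3
      have h12 : z w * (t * ((z w)⁻¹ + s)) = t + s * (z w * t) := by field_simp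
      rw [h11, mul_one] at h12
      linarith
    have h4 : t ≤ 2 / η := by
      rw [ht, inv_le_comm₀ (by linarith) (by positivity), inv_div]; exact hpos.le
    have h5 : z w * t ≤ 1 / η * (2 / η) := mul_le_mul h2.le h4 ht0.le (by positivity)
    rw [e, abs_mul, abs_of_pos (mul_pos hzw ht0)]
    calc |s| * (z w * t) ≤ η ^ 3 / 2 * (1 / η * (2 / η)) := by gcongr
      _ = η := by field_simp
  have hdist' := abs_le.1 hdist
  have hupd : ∀ u, Function.update z.ofLp w t u = if u = w then t else z u := fun u => by
    by_cases hu : u = w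
    · subst hu; simp
    · simp [hu]
  have := hfar (.inr (⌈z w0⌉₊, n, m)) (WithLp.toLp 2 (Function.update z.ofLp w t))
    ⟨⟨fun u => ?_, w0, ?_⟩, ⟨hn, hnN⟩, ?_⟩
  · rw [dist_update] at this
    linarith
  · simp only [hupd]
    split_ifs
    · linarith
    · exact hz u
  · have h6 := Nat.ceil_lt_add_one (show 0 ≤ z w0 by linarith [hz w0])
    simp only [hupd]
    split_ifs with h7
    · subst h7; linarith
    · linarith
  · have h8 := Finset.add_sum_erase Finset.univ (fun u => (n u : ℝ) * (z u)⁻¹) (Finset.mem_univ w)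
    rw [← Finset.add_sum_erase _ _ (Finset.mem_univ w)]
    have h9 : ∑ u ∈ Finset.univ.erase w, (n u : ℝ) * (Function.update z.ofLp w t u)⁻¹ =
        ∑ u ∈ Finset.univ.erase w, (n u : ℝ) * (z u)⁻¹ := by
      refine Finset.sum_congr rfl fun u hu => ?_
      rw [Function.update_of_ne (Finset.ne_of_mem_erase hu)]
    have h10 : (n w : ℝ) * s = m - ∑ u, n u * (z u)⁻¹ := by rw [hs]; field_simp
    simp only [h9, Function.update_self]
    rw [ht, inv_inv, mul_add, h10]
    linarith

end Geometry

/-! ### Conclusion -/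

theorem NonResonant.mono {ι : Type*} [Fintype ι] {α : ι → ℝ} {N N' : ℕ} {δ : ℝ}
    (h : NonResonant α N δ) (hN : N' ≤ N) : NonResonant α N' δ :=
  fun n hn hnN => h n hn fun w => (hnN w).trans (by exact_mod_cast hN)

/-- The conclusions hold, with constants depending only on the quality of the nonresonance, for all
multipliers whose products are bounded by `M`. -/
theorem exists_order_of_nonResonance (d k ℓ' c : ℕ) (hℓ' : 1 ≤ ℓ') (hc : 1 ≤ c) (M : ℕ) :
    ∃ N : ℕ, ∀ δ : ℝ, 0 < δ → δ ≤ 1 → ∃ R₀ : ℝ, 0 < R₀ ∧ ∀ R₁ : ℝ, R₀ ≤ R₁ →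
      ∀ lam : List (Fin d) → ℝ, Expanding k lam →
        (∀ w : List (Fin d), w ≠ [] → w.length ≤ k → prodMult lam w ≤ M) →
        NonResonant (fun w : Node d k => (prodMult lam w.1)⁻¹) N δ →
        ∀ R : ℝ, R₁ ≤ R → ∀ v : List (Fin d) → ℝ,
          (∀ y : ℤ, ∃ y' : ℤ, |(y : ℝ) - y'| ≤ R₁ ∧
            HasSmallErrors k lam v (1 / ((k * d ^ k + 1) * ℓ')) y') ∧
          (∀ y' : ℤ, HasSmallErrors k lam v (1 / ((k * d ^ k + 1) * ℓ')) y' →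
            |1 / R * ∫ x in (0 : ℝ)..R,
              cumDiff (translateNeg (imageMeasure k lam v) y') (scaledLeb (totalMult k lam)⁻¹) x| ≤
                1 / ℓ') ∧
          (∀ y' : ℤ, HasSmallErrors k lam v (1 / ((k * d ^ k + 1) * ℓ')) y' →
            |cramerDist R (translateNeg (imageMeasure k lam v) y')
              (scaledLeb (totalMult k lam)⁻¹) ^ 2 - cramerFormula k lam| < 1 / ℓ') ∧
          (∀ i : Leaf d k, ∀ m < k,
            upperDensity R (nearHalf lam v (ancestor m i.toList) (1 / (3 * c * ℓ'))) <
              ENNReal.ofReal (1 / (c * ℓ'))) := by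
  have hℓ : (1 : ℝ) ≤ ℓ' := by exact_mod_cast hℓ'
  obtain ⟨K, hK⟩ : ∃ K : ℝ, K = k * d ^ k := ⟨_, rfl⟩
  have hK0 : 0 ≤ K := by rw [hK]; positivity
  rw [← hK]
  obtain ⟨ε, hε⟩ : ∃ ε : ℝ, ε = 1 / ((K + 1) * ℓ') := ⟨_, rfl⟩
  have hε0 : 0 < ε := by rw [hε]; positivity
  have hKε : K * ε + ε = 1 / ℓ' := by rw [hε]; field_simp
  have hε1 : K * ε ≤ 1 := by
    have : 1 / (ℓ' : ℝ) ≤ 1 := by rw [div_le_one (by linarith)]; exact hℓ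
    linarith
  rw [← hε]
  obtain ⟨A, hA⟩ : ∃ A : ℝ, A = (K + 1) ^ 2 * (5 * 3 ^ k) := ⟨_, rfl⟩
  obtain ⟨B, hB⟩ : ∃ B : ℝ, B = d ^ k + k * d ^ k + 1 := ⟨_, rfl⟩
  have hA0 : 0 ≤ A := by rw [hA]; positivity
  -- The number `Q` of shifts and the precision `κ` of the return times.
  obtain ⟨Q, hQ4, hQA⟩ : ∃ Q : ℕ, 4 ≤ Q ∧ A * (14 / Q) ≤ ε / 4 := by
    obtain ⟨Q, hQ⟩ := exists_nat_gt (56 * A / ε)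
    refine ⟨Q + 4, by omega, ?_⟩
    have h1 : 56 * A / ε ≤ (Q + 4 : ℕ) := by push_cast; linarith
    rw [div_le_iff₀ hε0] at h1
    rw [mul_div_assoc', div_le_iff₀ (by positivity)]
    linarith
  have hQ4' : (4 : ℝ) ≤ Q := by exact_mod_cast hQ4
  obtain ⟨κ, hκ⟩ : ∃ κ : ℝ, κ = min (1 / (16 * (Q : ℝ) ^ 2)) (min ε (1 / 4) / (2 * (M + 1))) := ⟨_, rfl⟩
  have hmin : 0 < min ε (1 / 4) := lt_min hε0 (by norm_num)
  have hκ0 : 0 < κ := by rw [hκ]; exact lt_min (by positivity) (by positivity)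
  have hκQ : 16 * κ * Q ^ 2 ≤ 1 := by
    have h1 : κ ≤ 1 / (16 * Q ^ 2) := by rw [hκ]; exact min_le_left _ _
    rw [le_div_iff₀ (by positivity)] at h1
    linarith
  have hκM : 2 * κ * M ≤ min ε (1 / 4) := by
    have h1 : κ ≤ min ε (1 / 4) / (2 * (M + 1)) := by rw [hκ]; exact min_le_right _ _
    rw [le_div_iff₀ (by positivity)] at h1
    linarith
  have hκ2 : κ ≤ 1 / 2 := by nlinarith
  have hq : 0 < c * ℓ' := Nat.mul_pos hc hℓ'
  have hq1 : (1 : ℝ) ≤ (c * ℓ' : ℕ) := by exact_mod_cast hq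
  obtain ⟨Na, hNa⟩ := exists_returns (Node d k) hκ0 hκ2
  obtain ⟨Nb, hNb⟩ := exists_returns Unit (κ := 1 / (6 * (c * ℓ' : ℕ))) (by positivity) (by
    rw [div_le_div_iff₀ (by positivity) (by norm_num)]; linarith)
  refine ⟨Na + ((Nb + 1) * M + 1), fun δ hδ hδ1 => ?_⟩
  obtain ⟨Ha, hHa⟩ := hNa δ hδ
  obtain ⟨Hb, hHb⟩ := hNb δ hδ
  obtain ⟨R₀, hR₀⟩ : ∃ R₀ : ℝ,
    R₀ = Ha + 1 + 8 * (A * Ha + B ^ 2) / ε + (2 + Hb) * (1 + δ) / δ := ⟨_, rfl⟩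
  have ht1 : 0 ≤ 8 * (A * Ha + B ^ 2) / ε := by positivity
  have ht2 : 0 ≤ (2 + Hb) * (1 + δ) / δ := by positivity
  have ht3 : (0 : ℝ) ≤ Ha := Nat.cast_nonneg _
  refine ⟨R₀, by linarith, fun R₁ hR₁ lam hlam hM hres R hR v => ?_⟩
  have hR0 : 0 < R := by linarith
  have hreta := hHa _ (hres.mono (by omega))
  have hmean : ∀ y' : ℤ, HasSmallErrors k lam v ε y' → _ := fun y' hy =>
    mean_cumDiff_bounds (v := v) (ε := ε) hlam hκ0.le hQ4 hκQ hreta (by rw [← hK]; exact hε1) hy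
      hK hA hB hR0
  have hsmall : 2 * (A * Ha + B ^ 2) / R ≤ ε / 4 := by
    have h1 : 8 * (A * Ha + B ^ 2) / ε ≤ R := by linarith
    rw [div_le_iff₀ hε0] at h1
    rw [div_le_iff₀ hR0]
    linarith
  refine ⟨fun y => ?_, fun y' hy => ?_, fun y' hy => ?_, fun i m hm => ?_⟩
  · obtain ⟨y', h1, h2⟩ := exists_hasSmallErrors (v := v) hlam hκ0.le hreta hM hκM y
    exact ⟨y', h1.trans (by linarith), h2⟩
  · exact (hmean y' hy).1.trans (by linarith)
  · exact (hmean y' hy).2.trans_lt (by linarith)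
  · have hi : i.toList.length = k := i.toList_length
    have hne := ancestor_ne_nil (w := i.toList) (m := m) (by omega)
    have hl : (ancestor m i.toList).length ≤ k := by rw [length_ancestor]; omega
    have hN : (Nb + 1) * M + 1 ≤ Na + ((Nb + 1) * M + 1) := by omega
    have hres1 := (hres.multiplier hlam hδ1 hne hl (hM _ hne hl) hN).mono (Nat.le_succ Nb)
    have hgap := hres.le_abs_mul_lam_sub hlam hδ1 hne hl (hM _ hne hl) hN one_ne_zero
      (by push_cast; rw [abs_one]; linarith [Int.natCast_nonneg Nb]) 1
    have hlw := hlam _ hne hl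
    push_cast at hgap
    rw [one_mul, abs_of_pos (by linarith)] at hgap
    have key := upperDensity_nearHalf_lt (v := v) hq (hHb _ hres1) hδ (by linarith) (R := R)
      (by linarith)
    push_cast at key
    rwa [← mul_assoc] at key

end TreeLinear

theorem mainTheorem11 (d k : ℕ) (hd : 2 ≤ d) (ℓ' c : ℕ) (hℓ' : 1 ≤ ℓ') (hc : 1 ≤ c) :
    ∃ V : ℕ → Set (EuclideanSpace ℝ (TreeLinear.Node d k)),
      TreeLinear.IsLocFiniteSubmanifolds V ∧
      ∀ η' : ℝ, 0 < η' → ∃ R₀ : ℝ, 0 < R₀ ∧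
        ∀ lam : List (Fin d) → ℝ,
          (∀ w : TreeLinear.Node d k, 1 < lam w.1) →
          (∀ q : ℕ, ENNReal.ofReal η' <
            Metric.infEDist (TreeLinear.prodMultVec k lam) (V q)) →
          ∀ R : ℝ, R₀ ≤ R → ∀ v : List (Fin d) → ℝ,
            -- (i)
            (∀ y : ℤ, ∃ y' : ℤ, |(y : ℝ) - y'| ≤ R₀ ∧
              TreeLinear.HasSmallErrors k lam v (1 / ((k * d ^ k + 1) * ℓ')) y') ∧
            -- (ii)
            (∀ y' : ℤ,
              TreeLinear.HasSmallErrors k lam v (1 / ((k * d ^ k + 1) * ℓ')) y' →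
              |1 / R * ∫ x in (0 : ℝ)..R,
                TreeLinear.cumDiff
                  (TreeLinear.translateNeg (TreeLinear.imageMeasure k lam v) y')
                  (TreeLinear.scaledLeb (TreeLinear.totalMult k lam)⁻¹) x| ≤ 1 / ℓ') ∧
            -- (iii)
            (∀ y' : ℤ,
              TreeLinear.HasSmallErrors k lam v (1 / ((k * d ^ k + 1) * ℓ')) y' →
              |TreeLinear.cramerDist R
                  (TreeLinear.translateNeg (TreeLinear.imageMeasure k lam v) y')
                  (TreeLinear.scaledLeb (TreeLinear.totalMult k lam)⁻¹) ^ 2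
                - TreeLinear.cramerFormula k lam| < 1 / ℓ') ∧
            -- (iv)
            (∀ i : TreeLinear.Leaf d k, ∀ m < k,
              TreeLinear.upperDensity R
                  (TreeLinear.nearHalf lam v (TreeLinear.ancestor m i.toList)
                    (1 / (3 * c * ℓ'))) <
                ENNReal.ofReal (1 / (c * ℓ'))) := by
  choose N hN using TreeLinear.exists_order_of_nonResonance d k ℓ' c hℓ' hc
  obtain ⟨V, hV, hVi⟩ := TreeLinear.exists_isLocFiniteSubmanifolds (d := d) (k := k) N
  refine ⟨V, hV, fun η' hη' => ?_⟩
  obtain ⟨η, hη⟩ : ∃ η : ℝ, η = min η' (1 / 2) := ⟨_, rfl⟩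
  have hη0 : 0 < η := by rw [hη]; exact lt_min hη' (by norm_num)
  have hη2 : η ≤ 1 / 2 := by rw [hη]; exact min_le_right _ _
  have hηη' : η ≤ η' := by rw [hη]; exact min_le_left _ _
  have hδ1 : η ^ 3 / 2 ≤ 1 := by
    have : η ^ 3 ≤ 1 := pow_le_one₀ hη0.le (by linarith)
    linarith
  choose R₀ hR₀ hconc using fun M => hN M (η ^ 3 / 2) (by positivity) hδ1
  obtain ⟨T, hT⟩ := exists_nat_ge (1 / η)
  refine ⟨∑ M ∈ Finset.range (T + 1), R₀ M,
    Finset.sum_pos (fun M _ => hR₀ M) ⟨0, by simp⟩, fun lam hlam hfar => ?_⟩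
  have hexp : TreeLinear.Expanding k lam := fun w hw hk =>
    hlam ⟨w, List.length_pos_iff.2 hw, hk⟩
  have hmem : TreeLinear.prodMultVec k lam ∈ TreeLinear.multiplierSpace d k := fun w =>
    hexp.one_lt_prodMult (List.length_pos_iff.1 w.2.1) w.2.2
  have hfar' : ∀ i : TreeLinear.ResonanceIndex d k, ∀ x ∈ TreeLinear.resonanceSet N i,
      η < dist (TreeLinear.prodMultVec k lam) x := by
    intro i x hx
    obtain ⟨q, hq⟩ := hVi i
    rw [← hq] at hx
    have h1 := (hfar q).trans_le (Metric.infEDist_le_edist_of_mem hx)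
    rw [edist_dist] at h1
    exact hηη'.trans_lt (ENNReal.ofReal_lt_ofReal_iff_of_nonneg hη'.le |>.1 h1)
  obtain ⟨M, hMT, hMb, hres⟩ := TreeLinear.nonResonant_of_far hη0 hη2 hmem hfar' hT
  exact hconc M _ (Finset.single_le_sum (fun M _ => (hR₀ M).le)
    (Finset.mem_range.2 (Nat.lt_succ_of_le hMT))) lam hexp
    (fun w hw hk => hMb ⟨w, List.length_pos_iff.2 hw, hk⟩) hres
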